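/- Let $M$ be a smooth 4-dimensional manifold, $f\colon M\to\mathbb{R}^5$ a smooth immersion, and $\xi\colon M\to\mathbb{R}^5$ a smooth transversal vector field along $f$, i.e. $\mathbb{R}^5=f_*(T_xM)\oplus\mathbb{R}\xi_x$ (with $\xi_x\neq 0$) for every $x\in M$. Let $D$ be the standard flat connection of $\mathbb{R}^5$, and let the induced connection $\nabla$, the second fundamental form $h$, the shape operator $S$ and the transversal connection form $\tau$ be defined by $$D_Xf_*Y=f_*(\nabla_XY)+h(X,Y)\,\xi,\qquad D_X\xi=-f_*(SX)+\tau(X)\,\xi .$$ Assume that $f$ is non-degenerate ($h$ is non-degenerate at every point), that $\xi$ is locally equiaffine ($d\tau=0$), and that $h$ is Lorentzian, that is, has signature $(3,1)$ at every point. Let $\omega$ be an almost symplectic form on $M$, i.e. a smooth non-degenerate 2-form (not necessarily closed). Let $R(X,Y)Z=\nabla_X\nabla_YZ-\nabla_Y\nabla_XZ-\nabla_{[X,Y]}Z$ be the curvature tensor of $\nabla$; for a tensor $T$ of type $(0,p)$ let $R\cdot T$ be the tensor of type $(0,p+2)$ given by $$(R\cdot T)(X_1,\dots,X_{p+2})=-\sum_{i=3}^{p+2}T(X_3,\dots,R(X_1,X_2)X_i,\dots,X_{p+2}),$$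 and put $R^0\cdot T=T$, $R^k\cdot T=R\cdot(R^{k-1}\cdot T)$ for $k\ge 1$. If $R^k\cdot\omega=0$ for some integer $k\geq 1$, then the shape operator $S$ has rank at most $1$ at every point of $M$. -/

import Mathlib

open scoped Manifold ContDiff

noncomputable section

namespace AffineHypersurface

open VectorField FiberBundle

/-! ## Curvature, exterior derivative and the action of a curvature tensor -/

section General

variable {E : Type*} [NormedAddCommGroup E] [NormedSpace ℝ E]
  {M : Type*} [TopologicalSpace M] [ChartedSpace E M] [IsManifold 𝓘(ℝ, E) ∞ M]

/-- `R(X, Y)Z = ∇_X ∇_Y Z - ∇_Y ∇_X Z - ∇_[X, Y] Z` for vector fields `X`, `Y`, `Z`.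
As in Mathlib, `nabla Z x (X x)` stands for `(∇_X Z)(x)`. -/
def curvatureField
    (nabla : (Π x : M, TangentSpace 𝓘(ℝ, E) x) →
      (Π x : M, TangentSpace 𝓘(ℝ, E) x →L[ℝ] TangentSpace 𝓘(ℝ, E) x))
    (X Y Z : Π x : M, TangentSpace 𝓘(ℝ, E) x) (x : M) : TangentSpace 𝓘(ℝ, E) x :=
  nabla (fun y => nabla Z y (Y y)) x (X x) - nabla (fun y => nabla Z y (X y)) x (Y x)
    - nabla Z x (mlieBracket 𝓘(ℝ, E) X Y x)

/-- The curvature tensor `R(u, v)w` at the point `x`, for tangent vectors `u`, `v`, `w` at `x`: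
the three vectors are extended to vector fields that are smooth near `x`
(`FiberBundle.extend`); by tensoriality the choice of the extensions is immaterial. -/
def curvatureTensor
    (nabla : (Π x : M, TangentSpace 𝓘(ℝ, E) x) →
      (Π x : M, TangentSpace 𝓘(ℝ, E) x →L[ℝ] TangentSpace 𝓘(ℝ, E) x))
    (x : M) (u v w : TangentSpace 𝓘(ℝ, E) x) : TangentSpace 𝓘(ℝ, E) x :=
  curvatureField nabla (extend E u) (extend E v) (extend E w) x

/-- `dτ(X, Y) = X(τ(Y)) - Y(τ(X)) - τ([X, Y])` for a 1-form `τ` and vector fields `X`, `Y`. -/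
def extDerivField (τ : Π x : M, TangentSpace 𝓘(ℝ, E) x →L[ℝ] ℝ)
    (X Y : Π x : M, TangentSpace 𝓘(ℝ, E) x) (x : M) : ℝ :=
  mvfderiv 𝓘(ℝ, E) (fun y => τ y (Y y)) x (X x) - mvfderiv 𝓘(ℝ, E) (fun y => τ y (X y)) x (Y x)
    - τ x (mlieBracket 𝓘(ℝ, E) X Y x)

/-- The 1-form `τ` is closed: `dτ = 0` at every point, on all pairs of tangent vectors. -/
def IsClosedOneForm (τ : Π x : M, TangentSpace 𝓘(ℝ, E) x →L[ℝ] ℝ) : Prop :=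
  ∀ (x : M) (u v : TangentSpace 𝓘(ℝ, E) x), extDerivField τ (extend E u) (extend E v) x = 0

/-- An almost symplectic form: a smooth non-degenerate 2-form (not necessarily closed). -/
structure IsAlmostSymplectic
    (Ω : Π x : M, TangentSpace 𝓘(ℝ, E) x →L[ℝ] TangentSpace 𝓘(ℝ, E) x →L[ℝ] ℝ) : Prop where
  smooth : ContMDiff 𝓘(ℝ, E) (𝓘(ℝ, E).prod 𝓘(ℝ, E →L[ℝ] E →L[ℝ] ℝ)) ∞
    (fun x => Bundle.TotalSpace.mk' (E →L[ℝ] E →L[ℝ] ℝ)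
      (E := fun x : M => TangentSpace 𝓘(ℝ, E) x →L[ℝ] TangentSpace 𝓘(ℝ, E) x →L[ℝ] ℝ) x (Ω x))
  alternating : ∀ (x : M) (u : TangentSpace 𝓘(ℝ, E) x), Ω x u u = 0
  nondegenerate : ∀ (x : M) (u : TangentSpace 𝓘(ℝ, E) x), (∀ v, Ω x u v = 0) → u = 0

end General

section Algebra

variable {V : Type*}

/-- For a tensor `T` of type `(0, p)`, the tensor `R · T` of type `(0, p + 2)`,
`(R · T)(X₁, X₂, X₃, …) = - ∑ᵢ T(X₃, …, R(X₁, X₂)Xᵢ, …)`, the sum being over `3 ≤ i ≤ p + 2`. -/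
def curvatureAction (R : V → V → V → V) {p : ℕ} (T : (Fin p → V) → ℝ) : (Fin (p + 2) → V) → ℝ :=
  fun X => -∑ i : Fin p, T (Function.update (fun j : Fin p => X (j.addNat 2)) i
    (R (X 0) (X 1) (X (i.addNat 2))))

/-- `R^k · T`, with `R^0 · T = T` and `R^(k+1) · T = R · (R^k · T)`. -/
def curvaturePower (R : V → V → V → V) {p : ℕ} (T : (Fin p → V) → ℝ) :
    (k : ℕ) → (Fin (p + 2 * k) → V) → ℝ
  | 0 => T
  | k + 1 => curvatureAction R (curvaturePower R T k)

/-- The form `B` has signature `(p, q)`: in some basis its matrix is `diag(1, …, 1, -1, …, -1)`,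
with `p` entries `1` and `q` entries `-1`. -/
def HasSignature [AddCommGroup V] [Module ℝ V] (B : V → V → ℝ) (p q : ℕ) : Prop :=
  ∃ b : Module.Basis (Fin p ⊕ Fin q) ℝ V, ∀ i j : Fin p ⊕ Fin q,
    B (b i) (b j) = if i = j then Sum.elim (fun _ => (1 : ℝ)) (fun _ => -1) i else 0

end Algebra

/-! ## Hypersurfaces with a transversal vector field -/

section Hypersurface

variable {E : Type*} [NormedAddCommGroup E] [NormedSpace ℝ E]
  {F : Type*} [NormedAddCommGroup F] [NormedSpace ℝ F]
  {M : Type*} [TopologicalSpace M] [ChartedSpace E M] [IsManifold 𝓘(ℝ, E) ∞ M]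

/-- `f : M → F` is a smoothly immersed hypersurface and `ξ` is a smooth vector field along `f`
that is transversal to it: `F = f_*(T_x M) ⊕ ℝ ξ_x`, the second summand being a line. -/
structure IsTransversalPair (f ξ : M → F) : Prop where
  smooth : ContMDiff 𝓘(ℝ, E) 𝓘(ℝ, F) ∞ f
  immersion : ∀ x : M, Function.Injective (mvfderiv 𝓘(ℝ, E) f x)
  smooth_transversal : ContMDiff 𝓘(ℝ, E) 𝓘(ℝ, F) ∞ ξ
  transversal_ne_zero : ∀ x : M, ξ x ≠ 0
  isCompl : ∀ x : M,
    IsCompl (LinearMap.range (mvfderiv 𝓘(ℝ, E) f x).toLinearMap) (Submodule.span ℝ {ξ x})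

/-- The linear map `T_x M × ℝ → F`, `(v, c) ↦ f_* v + c ξ_x`;
it is an isomorphism when `ξ` is transversal. -/
def gluing (f ξ : M → F) (x : M) : (TangentSpace 𝓘(ℝ, E) x × ℝ) →L[ℝ] F :=
  (mvfderiv 𝓘(ℝ, E) f x).coprod (ContinuousLinearMap.toSpanSingleton ℝ (ξ x))

/-- The component `v` in the decomposition `w = f_* v + c ξ_x`. -/
def tangentPart (f ξ : M → F) (x : M) : F →L[ℝ] TangentSpace 𝓘(ℝ, E) x :=
  (ContinuousLinearMap.fst ℝ (TangentSpace 𝓘(ℝ, E) x) ℝ).comp (gluing f ξ x).inverse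

/-- The component `c` in the decomposition `w = f_* v + c ξ_x`. -/
def transversalPart (f ξ : M → F) (x : M) : F →L[ℝ] ℝ :=
  (ContinuousLinearMap.snd ℝ (TangentSpace 𝓘(ℝ, E) x) ℝ).comp
    (gluing (E := E) f ξ x).inverse

/-- `(D_X f_* Y)(x)` as a linear map of `X x`, where `D` is the flat connection of `F`. -/
def flatDerivative (f : M → F) (Y : Π x : M, TangentSpace 𝓘(ℝ, E) x) (x : M) :
    TangentSpace 𝓘(ℝ, E) x →L[ℝ] F :=
  mvfderiv 𝓘(ℝ, E) (fun y => mvfderiv 𝓘(ℝ, E) f y (Y y)) x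

/-- The induced connection `∇`: the tangential component in the Gauss formula
`D_X f_* Y = f_* (∇_X Y) + h(X, Y) ξ`. -/
def inducedConnection (f ξ : M → F) (Y : Π x : M, TangentSpace 𝓘(ℝ, E) x) (x : M) :
    TangentSpace 𝓘(ℝ, E) x →L[ℝ] TangentSpace 𝓘(ℝ, E) x :=
  (tangentPart f ξ x).comp (flatDerivative f Y x)

/-- The second fundamental form `h` at the point `x`: the transversal component in the Gauss
formula, the vector `v` being extended to a vector field that is smooth near `x`. -/
def secondFundamentalForm (f ξ : M → F) (x : M) (u v : TangentSpace 𝓘(ℝ, E) x) : ℝ :=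
  transversalPart (E := E) f ξ x (flatDerivative f (extend E v) x u)

/-- The shape operator `S`: minus the tangential component in the Weingarten formula
`D_X ξ = -f_* (S X) + τ(X) ξ`. -/
def shapeOperator (f ξ : M → F) (x : M) :
    TangentSpace 𝓘(ℝ, E) x →L[ℝ] TangentSpace 𝓘(ℝ, E) x :=
  -(tangentPart f ξ x).comp (mvfderiv 𝓘(ℝ, E) ξ x)

/-- The transversal connection form `τ`: the transversal component in the Weingarten formula. -/
def transversalForm (f ξ : M → F) (x : M) : TangentSpace 𝓘(ℝ, E) x →L[ℝ] ℝ :=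
  (transversalPart (E := E) f ξ x).comp (mvfderiv 𝓘(ℝ, E) ξ x)

/-- The hypersurface is non-degenerate: so is `h` at every point. -/
def IsNondegenerate (f ξ : M → F) : Prop :=
  ∀ (x : M) (u : TangentSpace 𝓘(ℝ, E) x), (∀ v, secondFundamentalForm f ξ x u v = 0) → u = 0

/-- The transversal field is locally equiaffine: `dτ = 0`. -/
def IsLocallyEquiaffine (f ξ : M → F) : Prop :=
  IsClosedOneForm (E := E) (transversalForm (E := E) f ξ)

/-- The curvature tensor `R` of the induced connection at the point `x`. -/
def inducedCurvature (f ξ : M → F) (x : M) (u v w : TangentSpace 𝓘(ℝ, E) x) :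
    TangentSpace 𝓘(ℝ, E) x :=
  curvatureTensor (inducedConnection f ξ) x u v w

/-- The value at the point `x` of the tensor `R^k · Ω` of type `(0, 2 + 2 k)`. -/
def curvaturePowerForm (f ξ : M → F)
    (Ω : Π x : M, TangentSpace 𝓘(ℝ, E) x →L[ℝ] TangentSpace 𝓘(ℝ, E) x →L[ℝ] ℝ) (k : ℕ) (x : M) :
    (Fin (2 + 2 * k) → TangentSpace 𝓘(ℝ, E) x) → ℝ :=
  curvaturePower (inducedCurvature f ξ x) (fun X : Fin 2 → TangentSpace 𝓘(ℝ, E) x =>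
    Ω x (X 0) (X 1)) k

end Hypersurface

end AffineHypersurface

end

/-! The problem is pointwise. The Gauss equation R(X,Y)Z = h(Y,Z)SX − h(X,Z)SY expresses the
curvature through h and S (`inducedCurvature_eq`), and by the Ricci equation dτ = 0 makes S
self-adjoint for h (`chartForm_chartShape`). What remains is linear algebra on a Lorentzian 4-space,
carried out after complexification.

If X, Y are eigenvectors of R(X,Y) with opposite eigenvalues, and Z, W are eigenvectors with
eigenvalues z, w, then (R^k·ω)(X,Y,…,X,Y,Z,W) = (−(z+w))^k ω(Z,W). Hence ω(Z,W) = 0 whenever z + w ≠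
0, and k plays no further role (`eq_zero_of_complexPower_eq_zero`).

Let X, Y span an isotropic plane. Then R(X,Y) kills X and Y, and on the span of SX, SY its square is
minus the determinant of h(S·,·) on the plane; where this determinant is nonzero, ω(·,S·) vanishes
on the plane. The isotropic planes form two one-parameter families, the rulings of the null quadric.
Both the determinant and ω(·,S·) are polynomial in the parameter, so on each ruling one of them
vanishes identically (`VanishesOnEigenpairs.ruling`).

If ω(·,S·) vanishes on both rulings, it is a multiple of h, which forces S = 0
(`eq_zero_of_both_rulings`). If the determinant vanishes on one ruling, the reality of S forces S =
s·id + (rank at most one) (`RulingRelations.cases`). A nonzero s would give ω a kernel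
(`VanishesOnEigenpairs.eigenvalue_eq_zero`); so s = 0 and S has rank at most one. -/

noncomputable section

namespace AffineHypersurface

open VectorField FiberBundle

/-! ### Vector fields that are constant in a chart -/

section Chart

open Set Filter Topology

variable {E : Type*} [NormedAddCommGroup E] [NormedSpace ℝ E]
  {F : Type*} [NormedAddCommGroup F] [NormedSpace ℝ F]
  {M : Type*} [TopologicalSpace M] [ChartedSpace E M] [IsManifold 𝓘(ℝ, E) ∞ M]

omit [IsManifold 𝓘(ℝ, E) ∞ M] in
theorem isManifold_one [IsManifold 𝓘(ℝ, E) ∞ M] : IsManifold 𝓘(ℝ, E) 1 M :=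
  IsManifold.of_le (n := ∞) (by simp)

/-- The canonical extension of a tangent vector at `x` is constant in the chart at `x`. -/
theorem extend_eq_mfderivWithin_symm {x y : M} (hy : y ∈ (extChartAt 𝓘(ℝ, E) x).source)
    (v : TangentSpace 𝓘(ℝ, E) x) :
    extend E v y = mfderivWithin 𝓘(ℝ, E) 𝓘(ℝ, E) (extChartAt 𝓘(ℝ, E) x).symm
      (range 𝓘(ℝ, E)) (extChartAt 𝓘(ℝ, E) x y) v := by
  have := isManifold_one (E := E) (M := M)
  have h1 : (trivializationAt E (TangentSpace 𝓘(ℝ, E)) x ⟨x, v⟩).2 = v := by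
    have h := TangentBundle.continuousLinearMapAt_trivializationAt (I := 𝓘(ℝ, E))
      (x₀ := x) (x := x) (by simp)
    rw [mfderiv_extChartAt_self] at h
    have h2 := congrArg (fun L => L v) h
    rw [Bundle.Trivialization.continuousLinearMapAt_apply,
      Bundle.Trivialization.linearMapAt_apply, if_pos (by simp)] at h2
    exact h2
  have h := TangentBundle.symmL_trivializationAt (I := 𝓘(ℝ, E)) (x₀ := x) (x := y)
    (by simpa using hy)
  rw [← h]
  simp only [extend, h1]
  exact (Bundle.Trivialization.symmL_apply (R := ℝ) (trivializationAt E (TangentSpace 𝓘(ℝ, E)) x)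
    (b := y) (by simpa using hy) (v : E)).symm

theorem mfderiv_extChartAt_extend {x y : M} (hy : y ∈ (extChartAt 𝓘(ℝ, E) x).source)
    (v : TangentSpace 𝓘(ℝ, E) x) :
    mfderiv 𝓘(ℝ, E) 𝓘(ℝ, E) (extChartAt 𝓘(ℝ, E) x) y (extend E v y) = v := by
  have := isManifold_one (E := E) (M := M)
  rw [extend_eq_mfderivWithin_symm hy]
  exact congrArg (fun L => L v)
    (mfderiv_extChartAt_comp_mfderivWithin_extChartAt_symm' (I := 𝓘(ℝ, E)) hy)

theorem mvfderiv_extend {x y : M} (hy : y ∈ (extChartAt 𝓘(ℝ, E) x).source)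
    {g : M → F} {G : E → F} {G' : E →L[ℝ] F}
    (hG : HasFDerivAt G G' (extChartAt 𝓘(ℝ, E) x y))
    (hg : g =ᶠ[𝓝 y] G ∘ extChartAt 𝓘(ℝ, E) x) (v : TangentSpace 𝓘(ℝ, E) x) :
    mvfderiv 𝓘(ℝ, E) g y (extend E v y) = G' v := by
  have := isManifold_one (E := E) (M := M)
  have h1 := (hG.hasMFDerivAt.comp y
    (mdifferentiableAt_extChartAt (I := 𝓘(ℝ, E)) (by simpa using hy)).hasMFDerivAt).congr_of_eventuallyEq hg
  rw [mvfderiv, ContinuousLinearMap.comp_apply, h1.mfderiv]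
  exact congrArg G' (mfderiv_extChartAt_extend hy v)

theorem mvfderiv_of_chart {x : M} {g : M → F} {G : E → F} {G' : E →L[ℝ] F}
    (hG : HasFDerivAt G G' (extChartAt 𝓘(ℝ, E) x x))
    (hg : ∀ y ∈ (extChartAt 𝓘(ℝ, E) x).source, g y = G (extChartAt 𝓘(ℝ, E) x y))
    (v : TangentSpace 𝓘(ℝ, E) x) : mvfderiv 𝓘(ℝ, E) g x v = G' v := by
  have h := mvfderiv_extend (mem_extChartAt_source x) hG
    (eventually_of_mem (extChartAt_source_mem_nhds x) hg) v
  rwa [extend_apply_self] at h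

omit [IsManifold 𝓘(ℝ, E) ∞ M] in
theorem lieBracketWithin_eq_zero_of_eventually_const {V W : E → E} {u v p : E} {s : Set E}
    (hs : s = univ) (hV : V =ᶠ[𝓝 p] fun _ => u) (hW : W =ᶠ[𝓝 p] fun _ => v) :
    lieBracketWithin ℝ V W s p = 0 := by
  rw [hs, lieBracketWithin_univ, Filter.EventuallyEq.lieBracket_vectorField_eq hV hW]
  simp [lieBracket]

/-- The canonical extensions of two tangent vectors commute at the base point. -/
theorem mlieBracket_extend {x : M} (u v : TangentSpace 𝓘(ℝ, E) x) :
    mlieBracket 𝓘(ℝ, E) (extend E u) (extend E v) x = 0 := by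
  have := isManifold_one (E := E) (M := M)
  have key : ∀ w : TangentSpace 𝓘(ℝ, E) x, ∀ z ∈ (extChartAt 𝓘(ℝ, E) x).target,
      mpullbackWithin 𝓘(ℝ, E) 𝓘(ℝ, E) (extChartAt 𝓘(ℝ, E) x).symm
        (extend E w) (range 𝓘(ℝ, E)) z = (show E from w) := by
    intro w z hz
    rw [mpullbackWithin_apply, extend_eq_mfderivWithin_symm ((extChartAt 𝓘(ℝ, E) x).map_target hz),
      (extChartAt 𝓘(ℝ, E) x).right_inv hz]
    exact ContinuousLinearMap.IsInvertible.inverse_apply_self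
      (isInvertible_mfderivWithin_extChartAt_symm hz) w
  rw [mlieBracket, mlieBracketWithin_apply]
  have hz := extChartAt_target_mem_nhds (I := 𝓘(ℝ, E)) x
  exact (congrArg _ (lieBracketWithin_eq_zero_of_eventually_const (by simp)
    (eventually_of_mem hz (key u)) (eventually_of_mem hz (key v)))).trans (map_zero _)

end Chart
end AffineHypersurface
end

noncomputable section

namespace AffineHypersurface

open VectorField FiberBundle

/-! ### Calculus of the decomposition f_* v + c ξ on a vector space -/

section LocalData

open Set Filter Topology

variable {E : Type*} [NormedAddCommGroup E] [NormedSpace ℝ E]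
  {F : Type*} [NormedAddCommGroup F] [NormedSpace ℝ F]

/-- The gluing map `(v, c) ↦ f_* v + c ξ` of a pair of maps between vector spaces. -/
def localGluing (f ξ : E → F) (p : E) : (E × ℝ) →L[ℝ] F :=
  (fderiv ℝ f p).coprod (ContinuousLinearMap.toSpanSingleton ℝ (ξ p))

/-- `D_a f_* v` for constant vector fields `a`, `v` on a vector space. -/
def localSecond (f : E → F) (p a v : E) : F := fderiv ℝ (fun q => fderiv ℝ f q v) p a

variable {f ξ : E → F} {p : E}

theorem localGluing_apply (a : E) (c : ℝ) :
    localGluing f ξ p (a, c) = fderiv ℝ f p a + c • ξ p := by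
  simp [localGluing]

theorem contDiffAt_localGluing (hf : ContDiffAt ℝ ∞ f p) (hξ : ContDiffAt ℝ ∞ ξ p) :
    ContDiffAt ℝ ∞ (localGluing f ξ) p := by
  have h1 : ContDiffAt ℝ ∞ (fderiv ℝ f) p := hf.fderiv_right (by simp)
  have h2 : localGluing f ξ = fun q =>
      (fderiv ℝ f q).comp (ContinuousLinearMap.fst ℝ E ℝ) +
        (ContinuousLinearMap.smulRightL ℝ (E × ℝ) F (ContinuousLinearMap.snd ℝ E ℝ)) (ξ q) := by
    ext q x <;> simp [localGluing]
  rw [h2]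
  exact (h1.clm_comp contDiffAt_const).add (ContDiffAt.clm_apply contDiffAt_const hξ)

/-- Inversion of continuous linear maps is smooth at an isomorphism. This gives the smoothness of
tangential and transversal components, so that they can be differentiated again. -/
theorem contDiffAt_localGluing_inverse [CompleteSpace E] (hf : ContDiffAt ℝ ∞ f p)
    (hξ : ContDiffAt ℝ ∞ ξ p) (hi : (localGluing f ξ p).IsInvertible) :
    ContDiffAt ℝ ∞ (fun q => (localGluing f ξ q).inverse) p := by
  obtain ⟨e, he⟩ := hi
  have h := contDiffAt_map_inverse (𝕜 := ℝ) (n := ∞) e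
  rw [he] at h
  exact h.comp p (contDiffAt_localGluing hf hξ)

theorem contDiffAt_localSecond (hf : ContDiffAt ℝ ∞ f p) (a v : E) :
    ContDiffAt ℝ ∞ (fun q => localSecond f q a v) p := by
  have h1 : ContDiffAt ℝ ∞ (fun q => fderiv ℝ f q v) p :=
    (hf.fderiv_right (m := ∞) (by simp)).clm_apply contDiffAt_const
  exact (h1.fderiv_right (m := ∞) (by simp)).clm_apply contDiffAt_const

theorem localSecond_eq (hf : ContDiffAt ℝ ∞ f p) (a v : E) :
    localSecond f p a v = fderiv ℝ (fderiv ℝ f) p a v := by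
  have h : DifferentiableAt ℝ (fderiv ℝ f) p :=
    (hf.fderiv_right (m := ∞) (by simp)).differentiableAt (by simp)
  rw [localSecond, fderiv_clm_apply h (differentiableAt_const v)]
  simp

theorem localSecond_symm (hf : ContDiffAt ℝ ∞ f p) (a v : E) :
    localSecond f p a v = localSecond f p v a := by
  rw [localSecond_eq hf, localSecond_eq hf]
  exact (hf.isSymmSndFDerivAt (by simpa using WithTop.coe_le_coe.2 (le_top : (2 : ℕ∞) ≤ ⊤))).eq a v

/-- Symmetry of second derivatives for the map `q ↦ fderiv ℝ f q v`. It cancels the third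
derivatives of the immersion in the curvature. -/
theorem fderiv_localSecond_symm (hf : ContDiffAt ℝ ∞ f p) (u a v : E) :
    fderiv ℝ (fun q => localSecond f q a v) p u = fderiv ℝ (fun q => localSecond f q u v) p a := by
  have h1 : ContDiffAt ℝ ∞ (fun q => fderiv ℝ f q v) p :=
    (hf.fderiv_right (m := ∞) (by simp)).clm_apply contDiffAt_const
  exact localSecond_symm h1 u a

theorem localGluing_inverse_apply_transversal (hi : (localGluing f ξ p).IsInvertible) (c : ℝ) :
    (localGluing f ξ p).inverse (c • ξ p) = (0, c) := by
  have := hi.inverse_apply_self (0, c)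
  rwa [localGluing_apply, map_zero, zero_add] at this

theorem localGluing_inverse_apply_tangent (hi : (localGluing f ξ p).IsInvertible) (a : E) :
    (localGluing f ξ p).inverse (fderiv ℝ f p a) = (a, 0) := by
  have := hi.inverse_apply_self (a, 0)
  rwa [localGluing_apply, zero_smul, add_zero] at this

theorem fderiv_add_smul_inverse (hi : (localGluing f ξ p).IsInvertible) (w : F) :
    fderiv ℝ f p ((localGluing f ξ p).inverse w).1 +
      ((localGluing f ξ p).inverse w).2 • ξ p = w := by
  rw [← localGluing_apply]
  exact hi.self_apply_inverse w

end LocalData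

/-! ### Transfer of the decomposition between the manifold and the chart -/

section Hypersurface

open Set Filter Topology

variable {E : Type*} [NormedAddCommGroup E] [NormedSpace ℝ E] [CompleteSpace E]
  {F : Type*} [NormedAddCommGroup F] [NormedSpace ℝ F] [CompleteSpace F]
  {M : Type*} [TopologicalSpace M] [ChartedSpace E M] [IsManifold 𝓘(ℝ, E) ∞ M]

omit [CompleteSpace E] [CompleteSpace F] in
theorem contDiffAt_comp_extChartAt_symm {g : M → F} (hg : ContMDiff 𝓘(ℝ, E) 𝓘(ℝ, F) ∞ g) {x : M}
    {p : E} (hp : p ∈ (extChartAt 𝓘(ℝ, E) x).target) :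
    ContDiffAt ℝ ∞ (g ∘ (extChartAt 𝓘(ℝ, E) x).symm) p := by
  have h := hg.comp_contMDiffOn (contMDiffOn_extChartAt_symm (I := 𝓘(ℝ, E)) (n := ∞) x)
  exact (contMDiffOn_iff_contDiffOn.1 h).contDiffAt ((isOpen_extChartAt_target x).mem_nhds hp)

omit [CompleteSpace E] [CompleteSpace F] in
theorem mvfderiv_extend_of_contMDiff {g : M → F} (hg : ContMDiff 𝓘(ℝ, E) 𝓘(ℝ, F) ∞ g) {x y : M}
    (hy : y ∈ (extChartAt 𝓘(ℝ, E) x).source) (v : TangentSpace 𝓘(ℝ, E) x) :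
    mvfderiv 𝓘(ℝ, E) g y (extend E v y) =
      fderiv ℝ (g ∘ (extChartAt 𝓘(ℝ, E) x).symm) (extChartAt 𝓘(ℝ, E) x y) v := by
  have h := contDiffAt_comp_extChartAt_symm hg ((extChartAt 𝓘(ℝ, E) x).map_source hy)
  refine mvfderiv_extend hy (h.differentiableAt (by simp)).hasFDerivAt ?_ v
  filter_upwards [extChartAt_source_mem_nhds' hy] with z hz
  rw [Function.comp_apply, Function.comp_apply, (extChartAt 𝓘(ℝ, E) x).left_inv hz]

variable {f ξ : M → F} {x y : M}

local notation "φ" => extChartAt 𝓘(ℝ, E)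

omit [CompleteSpace E] [CompleteSpace F] in
theorem gluing_extend (h : IsTransversalPair (E := E) f ξ)
    (hy : y ∈ (φ x).source) (a : E) (c : ℝ) :
    gluing f ξ y (extend (x := x) E a y, c) =
      localGluing (f ∘ (φ x).symm) (ξ ∘ (φ x).symm) (φ x y) (a, c) := by
  rw [localGluing_apply]
  refine (ContinuousLinearMap.coprod_apply _ _ _).trans (congrArg₂ _ ?_ ?_)
  · exact mvfderiv_extend_of_contMDiff h.smooth hy _
  · rw [Function.comp_apply, (φ x).left_inv hy]
    rfl

omit [CompleteSpace E] [CompleteSpace F] [IsManifold 𝓘(ℝ, E) ∞ M] in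
theorem gluing_bijective (h : IsTransversalPair (E := E) f ξ) (y : M) :
    Function.Bijective (gluing (E := E) f ξ y) := by
  have hc := h.isCompl y
  constructor
  · rw [injective_iff_map_eq_zero]
    rintro ⟨v, c⟩ hv
    have hv' : mvfderiv 𝓘(ℝ, E) f y v + c • ξ y = 0 := by simpa [gluing] using hv
    have h0 : c • ξ y = 0 := by
      refine (Submodule.disjoint_def.1 hc.disjoint) _ ?_
        (Submodule.smul_mem _ _ (Submodule.mem_span_singleton_self _))
      exact ⟨-v, by simpa using neg_eq_of_add_eq_zero_right hv'⟩
    have hc0 : c = 0 := (smul_eq_zero.1 h0).resolve_right (h.transversal_ne_zero y)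
    have hv0 : v = 0 := by
      apply h.immersion y
      rw [h0, add_zero] at hv'
      rw [hv', map_zero]
    rw [hc0, hv0]
    rfl
  · intro w
    have hw : w ∈ (LinearMap.range (mvfderiv 𝓘(ℝ, E) f y).toLinearMap) ⊔
        Submodule.span ℝ {ξ y} := by
      rw [hc.sup_eq_top]
      trivial
    obtain ⟨_, ⟨v, rfl⟩, b, hb, rfl⟩ := Submodule.mem_sup.1 hw
    obtain ⟨c, rfl⟩ := Submodule.mem_span_singleton.1 hb
    exact ⟨(v, c), by simp [gluing]⟩

omit [CompleteSpace E] in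
theorem exists_equiv_extend (hy : y ∈ (φ x).source) :
    ∃ e : E ≃L[ℝ] TangentSpace 𝓘(ℝ, E) y, ∀ a : E, e a = extend (x := x) E a y := by
  have := isManifold_one (E := E) (M := M)
  obtain ⟨e, he⟩ := isInvertible_mfderiv_extChartAt (I := 𝓘(ℝ, E)) hy
  refine ⟨e.symm, fun a => ?_⟩
  have h := mfderiv_extChartAt_extend hy a
  rw [← he] at h
  exact (e.symm_apply_eq).2 h.symm

theorem isInvertible_localGluing (h : IsTransversalPair (E := E) f ξ) (hy : y ∈ (φ x).source) :
    (localGluing (f ∘ (φ x).symm) (ξ ∘ (φ x).symm) (φ x y)).IsInvertible := by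
  obtain ⟨e, he⟩ := exists_equiv_extend (x := x) hy
  have hb : Function.Bijective
      (localGluing (f ∘ (φ x).symm) (ξ ∘ (φ x).symm) (φ x y)) := by
    have h1 : (localGluing (f ∘ (φ x).symm) (ξ ∘ (φ x).symm) (φ x y) : E × ℝ → F) =
        gluing f ξ y ∘ (e.prodCongr (ContinuousLinearEquiv.refl ℝ ℝ)) := by
      funext ⟨a, c⟩
      rw [← gluing_extend h hy]
      simp [he]
    rw [h1]
    exact (gluing_bijective h y).comp (ContinuousLinearEquiv.bijective _)
  exact ⟨ContinuousLinearEquiv.ofBijective _ (LinearMap.ker_eq_bot.2 hb.1)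
    (LinearMap.range_eq_top.2 hb.2), rfl⟩

theorem isInvertible_gluing (h : IsTransversalPair (E := E) f ξ) (y : M) :
    (gluing (E := E) f ξ y).IsInvertible := by
  have hy := mem_extChartAt_source (I := 𝓘(ℝ, E)) y
  obtain ⟨e, he⟩ := exists_equiv_extend (x := y) hy
  have h1 := isInvertible_localGluing h hy
  have h2 : localGluing (f ∘ (φ y).symm) (ξ ∘ (φ y).symm) (φ y y) =
      (gluing f ξ y).comp (e.prodCongr (ContinuousLinearEquiv.refl ℝ ℝ)).toContinuousLinearMap := by
    refine ContinuousLinearMap.ext fun ac => ?_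
    rw [← gluing_extend h hy]
    exact congrArg (gluing f ξ y) (Prod.ext (he ac.1).symm rfl)
  rw [h2] at h1
  exact ContinuousLinearMap.isInvertible_comp_equiv.1 h1

/-- The decomposition at any `y` in the chart domain around `x` is the one in the chart, the
tangential component being carried over by the chart-constant field. All induced objects are
computed in the chart through this identity. -/
theorem gluing_inverse (h : IsTransversalPair (E := E) f ξ) (hy : y ∈ (φ x).source) (w : F) :
    (gluing f ξ y).inverse w = (extend E (x := x)
      ((localGluing (f ∘ (φ x).symm) (ξ ∘ (φ x).symm) (φ x y)).inverse w).1 y,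
      ((localGluing (f ∘ (φ x).symm) (ξ ∘ (φ x).symm) (φ x y)).inverse w).2) := by
  have h1 := gluing_extend h hy
    ((localGluing (f ∘ (φ x).symm) (ξ ∘ (φ x).symm) (φ x y)).inverse w).1
    ((localGluing (f ∘ (φ x).symm) (ξ ∘ (φ x).symm) (φ x y)).inverse w).2
  rw [Prod.mk.eta, (isInvertible_localGluing h hy).self_apply_inverse] at h1
  exact ((isInvertible_gluing h y).inverse_apply_eq).2 h1.symm

end Hypersurface
end AffineHypersurface
end

noncomputable section

namespace AffineHypersurface

open VectorField FiberBundle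

/-! ### The Gauss and Ricci equations -/

section Equations

open Set Filter Topology

variable {E : Type*} [NormedAddCommGroup E] [NormedSpace ℝ E] [CompleteSpace E]
  {F : Type*} [NormedAddCommGroup F] [NormedSpace ℝ F] [CompleteSpace F]
  {M : Type*} [TopologicalSpace M] [ChartedSpace E M] [IsManifold 𝓘(ℝ, E) ∞ M]

variable {f ξ : M → F} {x y : M}

local notation "φ" => extChartAt 𝓘(ℝ, E)

/-- The vector field that is constant, with value `a`, in the chart at `x`. -/
def chartField (x : M) (a : E) (y : M) : TangentSpace 𝓘(ℝ, E) y := extend (x := x) E a y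

omit [CompleteSpace E] in
theorem chartField_self (x : M) (a : E) : chartField x a x = a :=
  extend_apply_self (F := E) (E := fun y : M => TangentSpace 𝓘(ℝ, E) y)
    (show TangentSpace 𝓘(ℝ, E) x from a)

omit [CompleteSpace E] in
theorem mlieBracket_chartField (a b : E) :
    mlieBracket 𝓘(ℝ, E) (chartField x a) (chartField x b) x = 0 := mlieBracket_extend _ _

omit [CompleteSpace E] [CompleteSpace F] in
theorem mvfderiv_chartField {g : M → F} (hg : ContMDiff 𝓘(ℝ, E) 𝓘(ℝ, F) ∞ g)
    (hy : y ∈ (φ x).source) (a : E) :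
    mvfderiv 𝓘(ℝ, E) g y (chartField x a y) = fderiv ℝ (g ∘ (φ x).symm) (φ x y) a :=
  mvfderiv_extend_of_contMDiff hg hy a

/-- The inverse of the gluing map, read in the chart at `x`. -/
def chartInverse (f ξ : M → F) (x : M) (p : E) : F →L[ℝ] E × ℝ :=
  (localGluing (f ∘ (φ x).symm) (ξ ∘ (φ x).symm) p).inverse

theorem tangentPart_eq (h : IsTransversalPair (E := E) f ξ) (hy : y ∈ (φ x).source) (w : F) :
    tangentPart f ξ y w = chartField x (chartInverse f ξ x (φ x y) w).1 y := by
  have := gluing_inverse h hy w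
  rw [tangentPart, ContinuousLinearMap.comp_apply, this]
  rfl

theorem transversalPart_eq (h : IsTransversalPair (E := E) f ξ) (hy : y ∈ (φ x).source) (w : F) :
    transversalPart (E := E) f ξ y w = (chartInverse f ξ x (φ x y) w).2 := by
  have := gluing_inverse h hy w
  rw [transversalPart, ContinuousLinearMap.comp_apply, this]
  rfl

theorem tangentPart_self (h : IsTransversalPair (E := E) f ξ) (w : F) :
    tangentPart f ξ x w = (chartInverse f ξ x (φ x x) w).1 := by
  rw [tangentPart_eq h (mem_extChartAt_source x), chartField_self]

omit [CompleteSpace E] [CompleteSpace F] in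
theorem flatDerivative_extend (h : IsTransversalPair (E := E) f ξ) (hy : y ∈ (φ x).source)
    (a v : E) :
    flatDerivative f (chartField x v) y (chartField x a y) =
      localSecond (f ∘ (φ x).symm) (φ x y) a v := by
  have hc := contDiffAt_comp_extChartAt_symm h.smooth ((φ x).map_source hy)
  have h1 : ContDiffAt ℝ ∞ (fun q => fderiv ℝ (f ∘ (φ x).symm) q v) (φ x y) :=
    (hc.fderiv_right (m := ∞) (by simp)).clm_apply contDiffAt_const
  refine mvfderiv_extend hy (h1.differentiableAt (by simp)).hasFDerivAt ?_ a
  filter_upwards [extChartAt_source_mem_nhds' hy] with z hz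
  exact mvfderiv_chartField h.smooth hz _

/-- The second fundamental form at `x`, read in the chart at `x`. -/
def chartForm (f ξ : M → F) (x : M) : E →L[ℝ] E →L[ℝ] ℝ :=
  (ContinuousLinearMap.compL ℝ E F ℝ
    ((ContinuousLinearMap.snd ℝ E ℝ).comp (chartInverse f ξ x (φ x x)))).comp
    (fderiv ℝ (fderiv ℝ (f ∘ (φ x).symm)) (φ x x))

/-- The shape operator at `x`, read in the chart at `x`. -/
def chartShape (f ξ : M → F) (x : M) : E →L[ℝ] E :=
  -((ContinuousLinearMap.fst ℝ E ℝ).comp (chartInverse f ξ x (φ x x))).comp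
    (fderiv ℝ (ξ ∘ (φ x).symm) (φ x x))

omit [CompleteSpace E] [CompleteSpace F] in
theorem chartForm_apply (h : IsTransversalPair (E := E) f ξ) (u v : E) :
    chartForm f ξ x u v =
      (chartInverse f ξ x (φ x x) (localSecond (f ∘ (φ x).symm) (φ x x) u v)).2 := by
  rw [localSecond_eq (contDiffAt_comp_extChartAt_symm h.smooth (mem_extChartAt_target x))]
  rfl

omit [CompleteSpace E] [CompleteSpace F] [IsManifold 𝓘(ℝ, E) ∞ M] in
theorem chartShape_apply (u : E) :
    chartShape f ξ x u =
      -(chartInverse f ξ x (φ x x) (fderiv ℝ (ξ ∘ (φ x).symm) (φ x x) u)).1 := rfl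

theorem secondFundamentalForm_eq (h : IsTransversalPair (E := E) f ξ) (u v : E) :
    secondFundamentalForm (E := E) f ξ x u v = chartForm f ξ x u v := by
  have h1 := flatDerivative_extend (x := x) h (mem_extChartAt_source x) u v
  rw [chartField_self] at h1
  rw [chartForm_apply h]
  exact (transversalPart_eq h (mem_extChartAt_source x) _).trans
    (congrArg (fun w => (chartInverse f ξ x (φ x x) w).2) h1)

theorem shapeOperator_eq (h : IsTransversalPair (E := E) f ξ) (u : E) :
    shapeOperator (E := E) f ξ x u = chartShape f ξ x u := by
  have h1 := mvfderiv_chartField h.smooth_transversal (mem_extChartAt_source x) u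
  rw [chartField_self] at h1
  refine congrArg Neg.neg ((tangentPart_self h _).trans ?_)
  exact congrArg (fun w => (chartInverse f ξ x (φ x x) w).1) h1

theorem inducedConnection_extend (h : IsTransversalPair (E := E) f ξ) (hy : y ∈ (φ x).source)
    (a v : E) :
    inducedConnection f ξ (chartField x v) y (chartField x a y) =
      chartField x
        (chartInverse f ξ x (φ x y) (localSecond (f ∘ (φ x).symm) (φ x y) a v)).1 y := by
  rw [inducedConnection, ContinuousLinearMap.comp_apply, flatDerivative_extend h hy,
    tangentPart_eq h hy]

theorem contDiffAt_chartInverse (h : IsTransversalPair (E := E) f ξ) :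
    ContDiffAt ℝ ∞ (chartInverse f ξ x) (φ x x) :=
  contDiffAt_localGluing_inverse
    (contDiffAt_comp_extChartAt_symm h.smooth (mem_extChartAt_target x))
    (contDiffAt_comp_extChartAt_symm h.smooth_transversal (mem_extChartAt_target x))
    (isInvertible_localGluing h (mem_extChartAt_source x))

/-- The tangential part of a field along `f`, differentiated once more. -/
theorem mvfderiv_tangent_field (h : IsTransversalPair (E := E) f ξ) {W : E → F}
    (hW : ContDiffAt ℝ ∞ W (φ x x)) (u : E) :
    chartInverse f ξ x (φ x x) (mvfderiv 𝓘(ℝ, E) (fun y => mvfderiv 𝓘(ℝ, E) f y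
      (chartField x (chartInverse f ξ x (φ x y) (W (φ x y))).1 y)) x u) =
    chartInverse f ξ x (φ x x) (fderiv ℝ W (φ x x) u)
      - (0, fderiv ℝ (fun p => (chartInverse f ξ x p (W p)).2) (φ x x) u)
      - (chartInverse f ξ x (φ x x) (W (φ x x))).2 •
        chartInverse f ξ x (φ x x) (fderiv ℝ (ξ ∘ (φ x).symm) (φ x x) u) := by
  have hξ := contDiffAt_comp_extChartAt_symm h.smooth_transversal (mem_extChartAt_target x)
  have hc : ContDiffAt ℝ ∞ (fun p => (chartInverse f ξ x p (W p)).2) (φ x x) :=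
    contDiffAt_snd.comp _ ((contDiffAt_chartInverse h).clm_apply hW)
  -- With c the transversal component of W, f_* of the tangential part is W − c ξ. Differentiating
  -- this form avoids differentiating the tangential part itself.
  have hG := (hW.differentiableAt (by simp)).hasFDerivAt.sub
    ((hc.differentiableAt (by simp)).hasFDerivAt.smul (hξ.differentiableAt (by simp)).hasFDerivAt)
  have h1 := mvfderiv_of_chart (x := x) (g := fun y => mvfderiv 𝓘(ℝ, E) f y
      (chartField x (chartInverse f ξ x (φ x y) (W (φ x y))).1 y)) hG ?_ u
  · rw [h1]
    have h2 := localGluing_inverse_apply_transversal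
      (isInvertible_localGluing h (mem_extChartAt_source x))
      (fderiv ℝ (fun p => (chartInverse f ξ x p (W p)).2) (φ x x) u)
    simp only [sub_apply, add_apply, map_sub, map_add,
      smul_apply, map_smul, ContinuousLinearMap.smulRight_apply]
    rw [← h2]
    simp only [chartInverse, map_smul]
    abel
  · intro z hz
    have h3 := fderiv_add_smul_inverse (isInvertible_localGluing h hz) (W (φ x z))
    rw [mvfderiv_chartField h.smooth hz]
    exact eq_sub_of_add_eq h3

/-- The field f_*(∇_v w) is D_v f_* w − h(v,w) ξ. In its derivative along u, the term with the
derivative of h(v,w) is a multiple of ξ and has no tangential part, while −h(v,w) D_u ξ contributes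
h(v,w) S u. -/
theorem inducedConnection_inducedConnection (h : IsTransversalPair (E := E) f ξ) (u v w : E) :
    inducedConnection (E := E) f ξ
      (fun y => inducedConnection f ξ (chartField x w) y (chartField x v y)) x u =
    ((chartInverse f ξ x (φ x x)
      (fderiv ℝ (fun p => localSecond (f ∘ (φ x).symm) p v w) (φ x x) u)).1 +
      chartForm f ξ x v w • chartShape f ξ x u : E) := by
  have hf := contDiffAt_comp_extChartAt_symm h.smooth (mem_extChartAt_target x)
  have h1 := mvfderiv_tangent_field h (contDiffAt_localSecond hf v w) u
  have h3 : (fun y => mvfderiv 𝓘(ℝ, E) f y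
      (inducedConnection f ξ (chartField x w) y (chartField x v y)))
      =ᶠ[𝓝 x] (fun y => mvfderiv 𝓘(ℝ, E) f y
      (chartField x (chartInverse f ξ x (φ x y)
        (localSecond (f ∘ (φ x).symm) (φ x y) v w)).1 y)) := by
    filter_upwards [extChartAt_source_mem_nhds (I := 𝓘(ℝ, E)) x] with z hz
    rw [inducedConnection_extend h hz]
  refine (tangentPart_self h _).trans ?_
  have h4 : flatDerivative f (fun y => inducedConnection f ξ (chartField x w) y
      (chartField x v y)) x u = mvfderiv 𝓘(ℝ, E) (fun y => mvfderiv 𝓘(ℝ, E) f y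
      (chartField x (chartInverse f ξ x (φ x y)
        (localSecond (f ∘ (φ x).symm) (φ x y) v w)).1 y)) x u := by
    have h5 := h3.mfderiv_eq (I := 𝓘(ℝ, E)) (I' := 𝓘(ℝ, F))
    exact congrArg (fun L => L u) h5
  have h6 := congrArg Prod.fst ((congrArg (chartInverse f ξ x (φ x x)) h4).trans h1)
  refine h6.trans ?_
  rw [chartForm_apply h, chartShape_apply]
  simp only [Prod.fst_sub, Prod.smul_fst]
  module

/-- The Gauss equation `R(u, v)w = h(v, w) S u - h(u, w) S v`. -/
theorem inducedCurvature_eq (h : IsTransversalPair (E := E) f ξ) (u v w : E) :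
    inducedCurvature (E := E) f ξ x u v w =
      (chartForm f ξ x v w • chartShape f ξ x u - chartForm f ξ x u w • chartShape f ξ x v : E) := by
  have hf := contDiffAt_comp_extChartAt_symm h.smooth (mem_extChartAt_target x)
  have h0 : inducedCurvature (E := E) f ξ x u v w =
      inducedConnection (E := E) f ξ
        (fun y => inducedConnection f ξ (chartField x w) y (chartField x v y)) x (chartField x u x) -
      inducedConnection (E := E) f ξ
        (fun y => inducedConnection f ξ (chartField x w) y (chartField x u y)) x (chartField x v x) -
      inducedConnection f ξ (chartField x w) x
        (mlieBracket 𝓘(ℝ, E) (chartField x u) (chartField x v) x) := rfl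
  rw [h0, mlieBracket_chartField, map_zero, sub_zero, chartField_self, chartField_self]
  refine (congrArg₂ (fun a b : E => a - b) (inducedConnection_inducedConnection h u v w)
    (inducedConnection_inducedConnection h v u w)).trans ?_
  -- The third-derivative terms are symmetric in u and v and cancel; only the terms with S survive.
  rw [fderiv_localSecond_symm hf u v w]
  abel_nf

theorem mvfderiv_transversalForm (h : IsTransversalPair (E := E) f ξ) (u v : E) :
    mvfderiv 𝓘(ℝ, E) (fun y => transversalForm (E := E) f ξ y (chartField x v y)) x u =
      fderiv ℝ (fun p => (chartInverse f ξ x p (fderiv ℝ (ξ ∘ (φ x).symm) p v)).2) (φ x x) u := by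
  have hξ := contDiffAt_comp_extChartAt_symm h.smooth_transversal (mem_extChartAt_target x)
  have hW : ContDiffAt ℝ ∞ (fun p => fderiv ℝ (ξ ∘ (φ x).symm) p v) (φ x x) :=
    (hξ.fderiv_right (m := ∞) (by simp)).clm_apply contDiffAt_const
  have hc : ContDiffAt ℝ ∞
      (fun p => (chartInverse f ξ x p (fderiv ℝ (ξ ∘ (φ x).symm) p v)).2) (φ x x) :=
    contDiffAt_snd.comp _ ((contDiffAt_chartInverse h).clm_apply hW)
  refine mvfderiv_of_chart (hc.differentiableAt (by simp)).hasFDerivAt (fun y hy => ?_) u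
  rw [transversalForm, ContinuousLinearMap.comp_apply,
    mvfderiv_chartField h.smooth_transversal hy, transversalPart_eq h hy]

/-- The Ricci equation. -/
theorem mvfderiv_transversalForm_eq (h : IsTransversalPair (E := E) f ξ) (u v : E) :
    mvfderiv 𝓘(ℝ, E) (fun y => transversalForm (E := E) f ξ y (chartField x v y)) x u =
      (chartInverse f ξ x (φ x x) (localSecond (ξ ∘ (φ x).symm) (φ x x) u v)).2
      + chartForm f ξ x u (chartShape f ξ x v)
      - (chartInverse f ξ x (φ x x) (fderiv ℝ (ξ ∘ (φ x).symm) (φ x x) v)).2 *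
        (chartInverse f ξ x (φ x x) (fderiv ℝ (ξ ∘ (φ x).symm) (φ x x) u)).2 := by
  have hξ := contDiffAt_comp_extChartAt_symm h.smooth_transversal (mem_extChartAt_target x)
  have hf := contDiffAt_comp_extChartAt_symm h.smooth (mem_extChartAt_target x)
  have hi := isInvertible_localGluing h (mem_extChartAt_source x)
  rw [mvfderiv_transversalForm h]
  set ξl := ξ ∘ (φ x).symm
  set fl := f ∘ (φ x).symm
  have hW : ContDiffAt ℝ ∞ (fun p => fderiv ℝ ξl p v) (φ x x) :=
    (hξ.fderiv_right (m := ∞) (by simp)).clm_apply contDiffAt_const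
  have hQ := (contDiffAt_chartInverse h).clm_apply hW
  have hσ : ContDiffAt ℝ ∞ (fun p => (chartInverse f ξ x p (fderiv ℝ ξl p v)).1) (φ x x) :=
    contDiffAt_fst.comp _ hQ
  have hτ : ContDiffAt ℝ ∞ (fun p => (chartInverse f ξ x p (fderiv ℝ ξl p v)).2) (φ x x) :=
    contDiffAt_snd.comp _ hQ
  have hdf : ContDiffAt ℝ ∞ (fderiv ℝ fl) (φ x x) := hf.fderiv_right (by simp)
  have hsum := ((hdf.differentiableAt (by simp)).hasFDerivAt.clm_apply
      (hσ.differentiableAt (by simp)).hasFDerivAt).add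
    ((hτ.differentiableAt (by simp)).hasFDerivAt.smul
      (hξ.differentiableAt (by simp)).hasFDerivAt)
  -- The Weingarten decomposition of D_v ξ holds near the point, so it may be differentiated by the
  -- product rule. In the transversal component of the result, the derivative of the tangential
  -- coefficient drops out (`h2`) and the derivative of τ(v) appears with factor one (`h3`).
  have heq : (fun p => fderiv ℝ ξl p v) =ᶠ[𝓝 (φ x x)]
      ((fun p => fderiv ℝ fl p (chartInverse f ξ x p (fderiv ℝ ξl p v)).1) +
      ((fun p => (chartInverse f ξ x p (fderiv ℝ ξl p v)).2) • ξl)) := by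
    filter_upwards [extChartAt_target_mem_nhds (I := 𝓘(ℝ, E)) x] with z hz
    have hz' := isInvertible_localGluing h ((φ x).map_target hz)
    rw [(φ x).right_inv hz] at hz'
    exact (fderiv_add_smul_inverse hz' _).symm
  have h1 := congrArg (fun L : E →L[ℝ] F => (chartInverse f ξ x (φ x x) (L u)).2)
    (heq.hasFDerivAt_iff.2 hsum).fderiv
  have h2 := localGluing_inverse_apply_tangent hi
    (fderiv ℝ (fun p => (chartInverse f ξ x p (fderiv ℝ ξl p v)).1) (φ x x) u)
  have h3 := localGluing_inverse_apply_transversal hi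
    (fderiv ℝ (fun p => (chartInverse f ξ x p (fderiv ℝ ξl p v)).2) (φ x x) u)
  have h4 : chartForm f ξ x u (chartShape f ξ x v) =
    -(chartInverse f ξ x (φ x x) (fderiv ℝ (fderiv ℝ fl) (φ x x) u
      (chartInverse f ξ x (φ x x) (fderiv ℝ ξl (φ x x) v)).1)).2 := by
    rw [chartShape_apply, map_neg]
    rfl
  rw [h4]
  change (chartInverse f ξ x (φ x x) _) = _ at h2
  change (chartInverse f ξ x (φ x x) _) = _ at h3
  simp only [add_apply, ContinuousLinearMap.comp_apply, ContinuousLinearMap.flip_apply, map_add,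
    smul_apply, map_smul, ContinuousLinearMap.smulRight_apply, Prod.snd_add, Prod.smul_snd,
    smul_eq_mul] at h1
  have h2' := congrArg Prod.snd h2
  have h3' := congrArg Prod.snd h3
  simp only [map_smul, Prod.smul_snd, smul_eq_mul] at h2' h3'
  rw [h2', h3'] at h1
  rw [localSecond, h1]
  ring

/-- For a closed transversal form the shape operator is self-adjoint. -/
theorem chartForm_chartShape (h : IsTransversalPair (E := E) f ξ)
    (hτ : IsLocallyEquiaffine (E := E) f ξ) (u v : E) :
    chartForm f ξ x u (chartShape f ξ x v) = chartForm f ξ x v (chartShape f ξ x u) := by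
  have hξ := contDiffAt_comp_extChartAt_symm h.smooth_transversal (mem_extChartAt_target x)
  have h0 : mvfderiv 𝓘(ℝ, E) (fun y => transversalForm (E := E) f ξ y (chartField x v y)) x
      (chartField x u x) -
    mvfderiv 𝓘(ℝ, E) (fun y => transversalForm (E := E) f ξ y (chartField x u y)) x
      (chartField x v x) -
    transversalForm (E := E) f ξ x (mlieBracket 𝓘(ℝ, E) (chartField x u) (chartField x v) x) = 0 :=
    hτ x u v
  rw [mlieBracket_chartField, map_zero, sub_zero, chartField_self, chartField_self] at h0
  have h1 := (congrArg₂ (fun a b : ℝ => a - b) (mvfderiv_transversalForm_eq h u v)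
    (mvfderiv_transversalForm_eq h v u)).symm.trans h0
  -- Second derivatives of ξ and the product τ(u)τ(v) are symmetric in u and v, so dτ reduces to the
  -- difference of the two terms h(·,S·).
  rw [localSecond_symm hξ u v] at h1
  linarith

end Equations
end AffineHypersurface
end

noncomputable section

namespace AffineHypersurface

/-! ### The iterated curvature action on complex multilinear forms -/

section ComplexAction

variable {V : Type*} [AddCommGroup V] [Module ℂ V]

/-- The Gauss curvature tensor `R(X, Y)Z = h(Y, Z) S X - h(X, Z) S Y`. -/
def gaussTensor {K V : Type*} [CommRing K] [AddCommGroup V] [Module K V]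
    (h : V →ₗ[K] V →ₗ[K] K) (S : V →ₗ[K] V) : V →ₗ[K] V →ₗ[K] V →ₗ[K] V :=
  LinearMap.mk₂ K (fun X Y => (h Y).smulRight (S X) - (h X).smulRight (S Y))
    (fun _ _ _ => by ext; simp; module) (fun _ _ _ => by ext; simp; module)
    (fun _ _ _ => by ext; simp; module) (fun _ _ _ => by ext; simp; module)

theorem gaussTensor_apply {K V : Type*} [CommRing K] [AddCommGroup V] [Module K V]
    (h : V →ₗ[K] V →ₗ[K] K) (S : V →ₗ[K] V) (X Y Z : V) :
    gaussTensor h S X Y Z = h Y Z • S X - h X Z • S Y := rfl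

theorem update_addNat_two_self {α : Type*} {p : ℕ} (X : Fin (p + 2) → α) (j : Fin p) (x : α) :
    (fun l : Fin p => Function.update X j.succ.succ x (l.addNat 2)) =
      Function.update (fun l : Fin p => X (l.addNat 2)) j x := by
  funext l
  by_cases h : l = j
  · subst h
    rw [Function.update_self]
    exact Function.update_self _ _ _
  · rw [Function.update_of_ne h]
    refine Function.update_of_ne (fun h1 => h ?_) _ _
    exact Fin.succ_injective _ (Fin.succ_injective _ h1)

theorem update_addNat_two_zero {α : Type*} {p : ℕ} (X : Fin (p + 2) → α) (x : α) (l : Fin p) :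
    Function.update X 0 x (l.addNat 2) = X (l.addNat 2) :=
  Function.update_of_ne (Fin.succ_ne_zero l.succ) _ _

theorem update_addNat_two_one {α : Type*} {p : ℕ} (X : Fin (p + 2) → α) (x : α) (l : Fin p) :
    Function.update X 1 x (l.addNat 2) = X (l.addNat 2) :=
  Function.update_of_ne (fun h => Fin.succ_ne_zero l (Fin.succ_injective _ h)) _ _

/-- A change in slot j + 2 affects either the vector on which the curvature acts (i = j) or a
spectator slot of T. In both cases the new entry appears once, which gives multilinearity of each
summand in that slot. -/
theorem update_comp_addNat_two {α β : Type*} {p : ℕ} (T : (Fin p → α) → β) (i : Fin p)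
    (r : α → α → α → α) (X : Fin (p + 2) → α) (j : Fin p) (x : α) :
    T (Function.update (fun l : Fin p => Function.update X j.succ.succ x (l.addNat 2)) i
      (r (Function.update X j.succ.succ x 0) (Function.update X j.succ.succ x 1)
        (Function.update X j.succ.succ x (i.addNat 2)))) =
    if i = j then T (Function.update (fun l : Fin p => X (l.addNat 2)) j (r (X 0) (X 1) x)) else
      T (Function.update (Function.update (fun l : Fin p => X (l.addNat 2)) i
        (r (X 0) (X 1) (X (i.addNat 2)))) j x) := by
  have h1 : Function.update X j.succ.succ x (i.addNat 2) =
      Function.update (fun l : Fin p => X (l.addNat 2)) j x i :=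
    congrFun (update_addNat_two_self X j x) i
  have h2 : Function.update X j.succ.succ x 1 = X 1 :=
    Function.update_of_ne (fun h => Fin.succ_ne_zero j (Fin.succ_injective _ h).symm) _ _
  rw [update_addNat_two_self, h1, h2, Function.update_of_ne (Fin.succ_ne_zero _).symm]
  by_cases h : i = j
  · subst h
    rw [if_pos rfl, Function.update_self, Function.update_idem]
  · rw [if_neg h, Function.update_of_ne h, Function.update_comm (Ne.symm h)]

/-- One summand of the action of a curvature tensor on a multilinear form. -/
def slotAction (R : V →ₗ[ℂ] V →ₗ[ℂ] V →ₗ[ℂ] V) {p : ℕ}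
    (T : MultilinearMap ℂ (fun _ : Fin p => V) ℂ) (i : Fin p) :
    MultilinearMap ℂ (fun _ : Fin (p + 2) => V) ℂ :=
  MultilinearMap.mk' (fun X => T (Function.update (fun j : Fin p => X (j.addNat 2)) i
      (R (X 0) (X 1) (X (i.addNat 2)))))
    (by
      intro X j x y
      refine Fin.cases ?_ (fun j => Fin.cases ?_ (fun j => ?_) j) j
      · simp [update_addNat_two_zero]
      · simp [update_addNat_two_one]
      · simp only [update_comp_addNat_two T i (fun a b c => R a b c)]
        split_ifs <;> simp)
    (by
      intro X j c x
      refine Fin.cases ?_ (fun j => Fin.cases ?_ (fun j => ?_) j) j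
      · simp [update_addNat_two_zero]
      · simp [update_addNat_two_one]
      · simp only [update_comp_addNat_two T i (fun a b c => R a b c)]
        split_ifs <;> simp)

/-- The action of a curvature tensor on complex multilinear forms. -/
def complexAction (R : V →ₗ[ℂ] V →ₗ[ℂ] V →ₗ[ℂ] V) {p : ℕ}
    (T : MultilinearMap ℂ (fun _ : Fin p => V) ℂ) :
    MultilinearMap ℂ (fun _ : Fin (p + 2) => V) ℂ :=
  -∑ i : Fin p, slotAction R T i

theorem complexAction_apply (R : V →ₗ[ℂ] V →ₗ[ℂ] V →ₗ[ℂ] V) {p : ℕ}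
    (T : MultilinearMap ℂ (fun _ : Fin p => V) ℂ) (X : Fin (p + 2) → V) :
    complexAction R T X = -∑ i : Fin p, T (Function.update (fun j : Fin p => X (j.addNat 2)) i
      (R (X 0) (X 1) (X (i.addNat 2)))) := by
  simp [complexAction, slotAction]

/-- The iterated action of a curvature tensor on complex multilinear forms. -/
def complexPower (R : V →ₗ[ℂ] V →ₗ[ℂ] V →ₗ[ℂ] V) {p : ℕ}
    (T : MultilinearMap ℂ (fun _ : Fin p => V) ℂ) :
    (k : ℕ) → MultilinearMap ℂ (fun _ : Fin (p + 2 * k) => V) ℂ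
  | 0 => T
  | k + 1 => complexAction R (complexPower R T k)

/-- On real vectors the complex and the real action follow the same recursion, because the complex
curvature sends real vectors to real vectors. -/
theorem complexPower_apply_of_intertwine {U : Type*} (ι : U → V) (R₀ : U → U → U → U)
    (R : V →ₗ[ℂ] V →ₗ[ℂ] V →ₗ[ℂ] V) (hR : ∀ a b c, R (ι a) (ι b) (ι c) = ι (R₀ a b c)) {p : ℕ}
    (T₀ : (Fin p → U) → ℝ) (T : MultilinearMap ℂ (fun _ : Fin p => V) ℂ)
    (hT : ∀ X, T (fun i => ι (X i)) = T₀ X) (k : ℕ) (X : Fin (p + 2 * k) → U) :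
    complexPower R T k (fun i => ι (X i)) = curvaturePower R₀ T₀ k X := by
  induction k with
  | zero => exact hT X
  | succ k ih =>
    refine (complexAction_apply R _ _).trans ?_
    simp only [hR]
    have h1 : ∀ i : Fin (p + 2 * k), (Function.update
        (fun j : Fin (p + 2 * k) => ι (X (j.addNat 2))) i
          (ι (R₀ (X 0) (X 1) (X (i.addNat 2))))) =
        fun l => ι (Function.update (fun j : Fin (p + 2 * k) => X (j.addNat 2)) i
          (R₀ (X 0) (X 1) (X (i.addNat 2))) l) := by
      intro i
      funext l
      by_cases hl : l = i
      · subst hl; simp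
      · simp [hl]
    refine (congrArg Neg.neg (Finset.sum_congr rfl fun i _ =>
      (congrArg (complexPower R T k) (h1 i)).trans (ih _))).trans ?_
    simp [curvaturePower, curvatureAction]

theorem complexPower_eq_zero {U ι : Type*} [AddCommGroup U] [Module ℝ U] [Finite ι]
    (e : Module.Basis ι ℂ V) (e₀ : ι → U) (j : U → V) (hj : ∀ i, j (e₀ i) = e i)
    (R₀ : U → U → U → U)
    (R : V →ₗ[ℂ] V →ₗ[ℂ] V →ₗ[ℂ] V) (hR : ∀ a b c, R (j a) (j b) (j c) = j (R₀ a b c)) {p : ℕ}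
    (T₀ : (Fin p → U) → ℝ) (T : MultilinearMap ℂ (fun _ : Fin p => V) ℂ)
    (hT : ∀ X, T (fun i => j (X i)) = T₀ X) (k : ℕ) (h0 : ∀ X, curvaturePower R₀ T₀ k X = 0) :
    complexPower R T k = 0 := by
  refine Module.Basis.ext_multilinear (fun _ => e) fun v => ?_
  simp only [← hj]
  rw [complexPower_apply_of_intertwine j R₀ R hR T₀ T hT k (fun i => e₀ (v i)), h0]
  simp

/-- The argument `(X, Y, …, X, Y, Z, W)` of the iterated action of a curvature tensor. -/
def repeatedArgument (X Y : V) {p : ℕ} (v : Fin p → V) : (k : ℕ) → Fin (p + 2 * k) → V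
  | 0 => v
  | k + 1 => Fin.cons X (Fin.cons Y (repeatedArgument X Y v k))

/-- All entries of the argument are eigenvectors of R(X,Y), and each adjoined pair X, Y contributes
a + (−a) = 0 to the sum of eigenvalues. Every application of the curvature thus multiplies by the
same factor −∑ w. -/
theorem complexPower_repeatedArgument (R : V →ₗ[ℂ] V →ₗ[ℂ] V →ₗ[ℂ] V) {p : ℕ}
    (T : MultilinearMap ℂ (fun _ : Fin p => V) ℂ) {X Y : V} {a : ℂ}
    (hX : R X Y X = a • X) (hY : R X Y Y = -a • Y) (v : Fin p → V) (w : Fin p → ℂ)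
    (hv : ∀ i, R X Y (v i) = w i • v i) (k : ℕ) :
    complexPower R T k (repeatedArgument X Y v k) = (-∑ i, w i) ^ k * T v := by
  have key : ∀ k, ∃ c : Fin (p + 2 * k) → ℂ, (∑ i, c i = ∑ i, w i) ∧
      ∀ i, R X Y (repeatedArgument X Y v k i) = c i • repeatedArgument X Y v k i := by
    intro k
    induction k with
    | zero => exact ⟨w, rfl, hv⟩
    | succ k ih =>
      obtain ⟨c, hc, hcv⟩ := ih
      refine ⟨(Fin.cons a (Fin.cons (-a) c) : Fin (p + 2 * k + 2) → ℂ), ?_, ?_⟩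
      · refine (Fin.sum_univ_succ _).trans ?_
        refine (congrArg (a + ·) (Fin.sum_univ_succ _)).trans ?_
        simp [hc]
      · intro i
        refine Fin.cases ?_ (fun i => Fin.cases ?_ (fun i => ?_) i) i
        · exact hX
        · exact hY
        · exact hcv i
  induction k with
  | zero => simp [complexPower, repeatedArgument]
  | succ k ih =>
    obtain ⟨c, hc, hcv⟩ := key k
    refine (complexAction_apply R _ _).trans ?_
    have h1 : ∀ i : Fin (p + 2 * k), complexPower R T k (Function.update
        (repeatedArgument X Y v k) i (R X Y (repeatedArgument X Y v k i))) =
        c i * complexPower R T k (repeatedArgument X Y v k) := by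
      intro i
      rw [hcv, MultilinearMap.map_update_smul, Function.update_eq_self, smul_eq_mul]
    refine (congrArg Neg.neg (Finset.sum_congr rfl fun i _ => h1 i)).trans ?_
    rw [← Finset.sum_mul, hc, ih]
    ring

/-- If `R ^ k · ω = 0` then `ω` vanishes on pairs of eigenvectors of `R(X, Y)` whose eigenvalues do
not add up to zero, provided that `X` and `Y` are eigenvectors with opposite eigenvalues. -/
theorem eq_zero_of_complexPower_eq_zero (R : V →ₗ[ℂ] V →ₗ[ℂ] V →ₗ[ℂ] V)
    (T : MultilinearMap ℂ (fun _ : Fin 2 => V) ℂ) {k : ℕ} (h0 : complexPower R T k = 0)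
    {X Y Z W : V} {a z w : ℂ} (hX : R X Y X = a • X) (hY : R X Y Y = -a • Y)
    (hZ : R X Y Z = z • Z) (hW : R X Y W = w • W) (hzw : z + w ≠ 0) : T ![Z, W] = 0 := by
  have h1 := complexPower_repeatedArgument R T hX hY ![Z, W] ![z, w]
    (fun i => by fin_cases i <;> simpa) k
  rw [h0] at h1
  have h2 : (-∑ i, ![z, w] i) ^ k ≠ 0 :=
    pow_ne_zero _ (neg_ne_zero.2 (by simpa using hzw))
  exact (mul_eq_zero.1 h1.symm).resolve_left h2

end ComplexAction
end AffineHypersurface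
end

noncomputable section

namespace AffineHypersurface

/-! ### Isotropic planes and the two rulings of the null quadric -/

section ComplexCore

variable {V : Type*} [AddCommGroup V] [Module ℂ V]

/-- `σ` vanishes on pairs of eigenvectors of `R(X, Y)` whose eigenvalues do not add up to zero,
whenever `X` and `Y` are eigenvectors of `R(X, Y)` with opposite eigenvalues. -/
def VanishesOnEigenpairs (h : V →ₗ[ℂ] V →ₗ[ℂ] ℂ) (S : V →ₗ[ℂ] V) (σ : V →ₗ[ℂ] V →ₗ[ℂ] ℂ) : Prop :=
  ∀ (X Y Z W : V) (a z w : ℂ), gaussTensor h S X Y X = a • X → gaussTensor h S X Y Y = -a • Y →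
    gaussTensor h S X Y Z = z • Z → gaussTensor h S X Y W = w • W → z + w ≠ 0 → σ Z W = 0

variable {h σ : V →ₗ[ℂ] V →ₗ[ℂ] ℂ} {S : V →ₗ[ℂ] V}

/-- Writing A for R(X,Y), the vectors AU + mU and AU − mU are eigenvectors for m and −m, while Z has
eigenvalue 0. Both pair to zero with Z, and their difference is 2mU. -/
theorem VanishesOnEigenpairs.eq_zero_of_sq (hE : VanishesOnEigenpairs h S σ) {X Y Z U : V} {m : ℂ}
    (hm : m ≠ 0) (hX : gaussTensor h S X Y X = 0) (hY : gaussTensor h S X Y Y = 0)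
    (hZ : gaussTensor h S X Y Z = 0)
    (hU : gaussTensor h S X Y (gaussTensor h S X Y U) = (m * m) • U) : σ Z U = 0 := by
  have key : ∀ n : ℂ, n ≠ 0 → n * n = m * m → σ Z (gaussTensor h S X Y U + n • U) = 0 := by
    intro n hn hnm
    refine hE X Y Z _ 0 0 n (by simpa using hX) (by simpa using hY) (by simpa using hZ) ?_
      (by simpa using hn)
    rw [map_add, hU, map_smul, ← hnm]
    module
  have h1 := key m hm rfl
  have h2 := key (-m) (neg_ne_zero.2 hm) (by ring)
  simp only [map_add, map_smul, smul_eq_mul] at h1 h2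
  have h3 : (2 * m) * σ Z U = 0 := by linear_combination h1 - h2
  exact (mul_eq_zero.1 h3).resolve_left (mul_ne_zero two_ne_zero hm)

/-- Isotropy gives R(X,Y)X = R(X,Y)Y = 0. On the span of SX and SY the operator R(X,Y) acts by a
matrix that is trace-free by self-adjointness, so its square is the scalar minus the determinant, by
Cayley–Hamilton. -/
theorem VanishesOnEigenpairs.isotropic_plane (hE : VanishesOnEigenpairs h S σ)
    (hsymm : ∀ x y, h x y = h y x) {X Y : V}
    (hXX : h X X = 0) (hXY : h X Y = 0) (hYY : h Y Y = 0)
    (hD : h X (S X) * h Y (S Y) - h X (S Y) * h Y (S X) ≠ 0)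
    (hadj : h X (S Y) = h Y (S X)) {Z W : V} (hZ : Z = X ∨ Z = Y) (hW : W = X ∨ W = Y) :
    σ Z (S W) = 0 := by
  obtain ⟨m, hm⟩ := IsAlgClosed.exists_pow_nat_eq
    (h X (S Y) * h Y (S X) - h X (S X) * h Y (S Y)) two_pos
  have hm0 : m ≠ 0 := by
    rintro rfl
    apply hD
    linear_combination hm
  have hX : gaussTensor h S X Y X = 0 := by
    rw [gaussTensor_apply, hXX, hsymm Y X, hXY]; simp
  have hY : gaussTensor h S X Y Y = 0 := by
    rw [gaussTensor_apply, hXY, hYY]; simp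
  refine hE.eq_zero_of_sq hm0 hX hY ?_ ?_
  · rcases hZ with rfl | rfl <;> assumption
  · rw [← sq, hm]
    rcases hW with rfl | rfl
    · simp only [gaussTensor_apply, map_sub, map_smul, hadj]
      module
    · simp only [gaussTensor_apply, map_sub, map_smul, hadj]
      module

/-- A polynomial vanishing at every complex number is zero, and ℂ[X] has no zero divisors. Degree 4
is that of the determinant along a ruling, degree 2 that of σ(·, S ·). -/
theorem eq_zero_or_eq_zero_of_mul_eq_zero {c₀ c₁ c₂ c₃ c₄ n₀ n₁ n₂ : ℂ}
    (H : ∀ z : ℂ, (c₀ + c₁ * z + c₂ * z ^ 2 + c₃ * z ^ 3 + c₄ * z ^ 4) *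
      (n₀ + n₁ * z + n₂ * z ^ 2) = 0) :
    (c₀ = 0 ∧ c₁ = 0 ∧ c₂ = 0 ∧ c₃ = 0 ∧ c₄ = 0) ∨ (n₀ = 0 ∧ n₁ = 0 ∧ n₂ = 0) := by
  open Polynomial in
  have h1 : (C c₀ + C c₁ * X + C c₂ * X ^ 2 + C c₃ * X ^ 3 + C c₄ * X ^ 4) *
      (C n₀ + C n₁ * X + C n₂ * X ^ 2) = 0 :=
    Polynomial.funext fun z => by simpa using H z
  rcases mul_eq_zero.1 h1 with h | h
  · left
    refine ⟨?_, ?_, ?_, ?_, ?_⟩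
    · simpa [Polynomial.coeff_X, Polynomial.coeff_C] using congrArg (fun q => Polynomial.coeff q 0) h
    · simpa [Polynomial.coeff_X, Polynomial.coeff_C] using congrArg (fun q => Polynomial.coeff q 1) h
    · simpa [Polynomial.coeff_X, Polynomial.coeff_C] using congrArg (fun q => Polynomial.coeff q 2) h
    · simpa [Polynomial.coeff_X, Polynomial.coeff_C] using congrArg (fun q => Polynomial.coeff q 3) h
    · simpa [Polynomial.coeff_X, Polynomial.coeff_C] using congrArg (fun q => Polynomial.coeff q 4) h
  · right
    refine ⟨?_, ?_, ?_⟩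
    · simpa [Polynomial.coeff_X, Polynomial.coeff_C] using congrArg (fun q => Polynomial.coeff q 0) h
    · simpa [Polynomial.coeff_X, Polynomial.coeff_C] using congrArg (fun q => Polynomial.coeff q 1) h
    · simpa [Polynomial.coeff_X, Polynomial.coeff_C] using congrArg (fun q => Polynomial.coeff q 2) h

/-- A null frame: `l, n` and `m, m'` span complementary hyperbolic planes. -/
structure IsNullFrame (h : V →ₗ[ℂ] V →ₗ[ℂ] ℂ) (l n m m' : V) : Prop where
  ll : h l l = 0
  nn : h n n = 0
  mm : h m m = 0
  m'm' : h m' m' = 0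
  ln : h l n = 2
  mm' : h m m' = 2
  lm : h l m = 0
  lm' : h l m' = 0
  nm : h n m = 0
  nm' : h n m' = 0

/-- The coefficients of the determinant of `h(S ·, ·)` on the planes of a ruling vanish. -/
def IsDegenerateRuling (h : V →ₗ[ℂ] V →ₗ[ℂ] ℂ) (S : V →ₗ[ℂ] V) (l n m m' : V) : Prop :=
  h l (S l) * h m' (S m') - h l (S m') ^ 2 = 0 ∧
    -2 * (h l (S l) * h m' (S n)) + 2 * (h l (S m) * h m' (S m')) -
      2 * (h l (S m') * (h m (S m') - h l (S n))) = 0 ∧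
    h l (S l) * h n (S n) - 4 * (h l (S m) * h m' (S n)) + h m (S m) * h m' (S m') -
      (h m (S m') - h l (S n)) ^ 2 + 2 * (h l (S m') * h m (S n)) = 0 ∧
    2 * (h l (S m) * h n (S n)) - 2 * (h m (S m) * h m' (S n)) +
      2 * ((h m (S m') - h l (S n)) * h m (S n)) = 0 ∧
    h m (S m) * h n (S n) - h m (S n) ^ 2 = 0

/-- The form `σ(·, S ·)` vanishes on the planes of a ruling. -/
def IsVanishingRuling (σ : V →ₗ[ℂ] V →ₗ[ℂ] ℂ) (S : V →ₗ[ℂ] V) (l n m m' : V) : Prop :=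
  (σ l (S l) = 0 ∧ σ l (S m) + σ m (S l) = 0 ∧ σ m (S m) = 0) ∧
    (σ m' (S m') = 0 ∧ σ m' (S n) + σ n (S m') = 0 ∧ σ n (S n) = 0) ∧
    (σ l (S m') = 0 ∧ σ m (S m') = σ l (S n) ∧ σ m (S n) = 0) ∧
    (σ m' (S l) = 0 ∧ σ m' (S m) = σ n (S l) ∧ σ n (S m) = 0)

/-- Along one of the two rulings of the null quadric, either all the planes are degenerate for
`h(S ·, ·)`, or `σ(·, S ·)` vanishes on all of them. -/
theorem VanishesOnEigenpairs.ruling (hE : VanishesOnEigenpairs h S σ)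
    (hsymm : ∀ x y, h x y = h y x) (hadj : ∀ x y, h x (S y) = h y (S x)) {l n m m' : V}
    (hF : IsNullFrame h l n m m') :
    IsDegenerateRuling h S l n m m' ∨ IsVanishingRuling σ S l n m m' := by
  -- The plane with parameter z is spanned by l + z m and m' − z n; it is isotropic because h(l,n) =
  -- h(m,m'). The quartic is the determinant of h(S ·, ·) on this plane.
  have hp : ∀ z : ℂ, ∀ Z W : V, (Z = l + z • m ∨ Z = m' - z • n) →
      (W = l + z • m ∨ W = m' - z • n) →
      ((h l (S l) * h m' (S m') - h l (S m') ^ 2) +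
      (-2 * (h l (S l) * h m' (S n)) + 2 * (h l (S m) * h m' (S m')) -
        2 * (h l (S m') * (h m (S m') - h l (S n)))) * z +
      (h l (S l) * h n (S n) - 4 * (h l (S m) * h m' (S n)) + h m (S m) * h m' (S m') -
        (h m (S m') - h l (S n)) ^ 2 + 2 * (h l (S m') * h m (S n))) * z ^ 2 +
      (2 * (h l (S m) * h n (S n)) - 2 * (h m (S m) * h m' (S n)) +
        2 * ((h m (S m') - h l (S n)) * h m (S n))) * z ^ 3 +
      (h m (S m) * h n (S n) - h m (S n) ^ 2) * z ^ 4) * σ Z (S W) = 0 := by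
    intro z Z W hZ hW
    by_contra hne
    have hD := left_ne_zero_of_mul hne
    refine right_ne_zero_of_mul hne (hE.isotropic_plane hsymm (X := l + z • m) (Y := m' - z • n)
      ?_ ?_ ?_ ?_ (hadj _ _) hZ hW)
    · simp [hF.ll, hF.mm, hF.lm, hsymm m l]
    · simp [hF.lm', hF.ln, hF.mm', hsymm m n, hF.nm]
    · simp [hF.m'm', hF.nn, hF.nm', hsymm m' n]
    · convert hD using 1
      simp only [map_add, map_sub, map_smul, LinearMap.add_apply, LinearMap.sub_apply,
        LinearMap.smul_apply, smul_eq_mul, hadj m l, hadj n m', hadj n m, hadj n l, hadj m' m,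
        hadj m' l]
      ring
  have hlin : ∀ Z₀ Z₁ W₀ W₁ : V, (∀ z : ℂ, (Z₀ + z • Z₁ = l + z • m ∨ Z₀ + z • Z₁ = m' - z • n)) →
      (∀ z : ℂ, (W₀ + z • W₁ = l + z • m ∨ W₀ + z • W₁ = m' - z • n)) →
      IsDegenerateRuling h S l n m m' ∨
      (σ Z₀ (S W₀) = 0 ∧ σ Z₀ (S W₁) + σ Z₁ (S W₀) = 0 ∧ σ Z₁ (S W₁) = 0) := by
    intro Z₀ Z₁ W₀ W₁ hZ hW
    refine eq_zero_or_eq_zero_of_mul_eq_zero fun z => ?_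
    rw [← hp z _ _ (hZ z) (hW z)]
    simp only [map_add, map_smul, LinearMap.add_apply, LinearMap.smul_apply, smul_eq_mul]
    ring
  have hX : ∀ z : ℂ, (l + z • m = l + z • m ∨ l + z • m = m' - z • n) := fun z => Or.inl rfl
  have hY : ∀ z : ℂ, (m' + z • (-n) = l + z • m ∨ m' + z • (-n) = m' - z • n) :=
    fun z => Or.inr (by module)
  rcases hlin _ _ _ _ hX hX with h0 | h1
  · exact Or.inl h0
  rcases hlin _ _ _ _ hY hY with h0 | h2
  · exact Or.inl h0
  rcases hlin _ _ _ _ hX hY with h0 | h3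
  · exact Or.inl h0
  rcases hlin _ _ _ _ hY hX with h0 | h4
  · exact Or.inl h0
  simp only [map_neg, LinearMap.neg_apply, neg_neg, neg_eq_zero] at h2 h3 h4
  refine Or.inr ⟨h1, ⟨h2.1, ?_, h2.2.2⟩, ⟨h3.1, ?_, h3.2.2⟩, ⟨h4.1, ?_, h4.2.2⟩⟩
  · linear_combination -h2.2.1
  · linear_combination h3.2.1
  · linear_combination h4.2.1

/-- If `σ(·, S ·)` vanishes on both rulings then `S = 0`. -/
theorem eq_zero_of_both_rulings (hsymm : ∀ x y, h x y = h y x)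
    (hnd : ∀ x, (∀ y, h x y = 0) → x = 0) (halt : ∀ x y, σ x y = -σ y x)
    (hσnd : ∀ x, (∀ y, σ x y = 0) → x = 0)
    (hadj : ∀ x y, h x (S y) = h y (S x)) {l n m m' : V} (hF : IsNullFrame h l n m m')
    (hspan : ∀ x, ∃ a b c d : ℂ, x = a • l + b • n + c • m + d • m')
    (h1 : IsVanishingRuling σ S l n m m') (h2 : IsVanishingRuling σ S l n m' m) : S = 0 := by
  obtain ⟨⟨a1, a2, a3⟩, ⟨a4, a5, a6⟩, ⟨a7, a8, a9⟩, ⟨a10, a11, a12⟩⟩ := h1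
  obtain ⟨⟨-, -, -⟩, ⟨-, -, -⟩, ⟨b7, b8, b9⟩, ⟨b10, b11, b12⟩⟩ := h2
  -- Vanishing on both rulings leaves of the sixteen entries of σ(·, S ·) only those on the pairs l,
  -- n and m, m', all equal. The factor 2 is the value h(l,n).
  have hN : ∀ x y, 2 * σ x (S y) = σ l (S n) * h x y := by
    intro x y
    obtain ⟨a, b, c, d, rfl⟩ := hspan x
    obtain ⟨a', b', c', d', rfl⟩ := hspan y
    simp only [map_add, map_smul, LinearMap.add_apply, LinearMap.smul_apply, smul_eq_mul,
      hF.ll, hF.nn, hF.mm, hF.m'm', hF.ln, hF.mm', hF.lm, hF.lm', hF.nm, hF.nm', hsymm n l,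
      hsymm m l, hsymm m' l, hsymm m n, hsymm m' n, hsymm m' m,
      a1, a3, a4, a6, a7, a9, a10, a12, b7, b8, b9, b10, b12, ← b11, a8]
    ring
  by_cases hc : σ l (S n) = 0
  · ext y
    apply hσnd
    intro x
    have := hN x y
    rw [hc, zero_mul] at this
    rw [halt, neg_eq_zero]
    exact (mul_eq_zero.1 this).resolve_left two_ne_zero
  · ext x
    apply hnd
    intro y
    -- 2σ(Sx,Sy) is a multiple of h(Sx,y), which is symmetric in x and y as S is self-adjoint,
    -- whereas σ is alternating; so both vanish.
    have e1 := hN (S x) y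
    have e2 := hN (S y) x
    have e3 := halt (S x) (S y)
    have e4 := hadj y x
    rw [hsymm] at e4
    have e5 : σ l (S n) * h (S x) y = 0 := by
      have e6 : h (S y) x = h (S x) y := by rw [hsymm (S y) x, ← e4]
      rw [e6] at e2
      linear_combination (1 / 2) * (-e1 - e2 + 2 * e3)
    exact (mul_eq_zero.1 e5).resolve_left hc

end ComplexCore
end AffineHypersurface
end

noncomputable section

namespace AffineHypersurface

/-! ### Self-adjoint operators in an orthonormal Lorentz frame -/

section LorentzFrame

variable {V : Type*} [AddCommGroup V] [Module ℂ V]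

/-- A frame that is orthonormal for a form of signature `(3, 1)`, the last vector being timelike. -/
structure IsLorentzFrame {K V : Type*} [CommRing K] [AddCommGroup V] [Module K V]
    (h : V →ₗ[K] V →ₗ[K] K) (e₁ e₂ e₃ e₄ : V) : Prop where
  h11 : h e₁ e₁ = 1
  h22 : h e₂ e₂ = 1
  h33 : h e₃ e₃ = 1
  h44 : h e₄ e₄ = -1
  h12 : h e₁ e₂ = 0
  h13 : h e₁ e₃ = 0
  h14 : h e₁ e₄ = 0
  h23 : h e₂ e₃ = 0
  h24 : h e₂ e₄ = 0
  h34 : h e₃ e₄ = 0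
  symm : ∀ x y, h x y = h y x
  span : ∀ x, ∃ a b c d : K, x = a • e₁ + b • e₂ + c • e₃ + d • e₄

variable {h σ : V →ₗ[ℂ] V →ₗ[ℂ] ℂ} {S : V →ₗ[ℂ] V} {e₁ e₂ e₃ e₄ : V}

theorem IsLorentzFrame.rotate {K V : Type*} [CommRing K] [AddCommGroup V] [Module K V]
    {h : V →ₗ[K] V →ₗ[K] K} {e₁ e₂ e₃ e₄ : V} (hF : IsLorentzFrame h e₁ e₂ e₃ e₄) :
    IsLorentzFrame h e₂ e₃ e₁ e₄ where
  h11 := hF.h22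
  h22 := hF.h33
  h33 := hF.h11
  h44 := hF.h44
  h12 := hF.h23
  h13 := by rw [hF.symm, hF.h12]
  h14 := hF.h24
  h23 := by rw [hF.symm, hF.h13]
  h24 := hF.h34
  h34 := hF.h14
  symm := hF.symm
  span x := by
    obtain ⟨a, b, c, d, rfl⟩ := hF.span x
    exact ⟨b, c, a, d, by module⟩

/-- This reflection exchanges the null vectors e₁ ± i e₂, hence the two rulings. -/
theorem IsLorentzFrame.reflect (hF : IsLorentzFrame h e₁ e₂ e₃ e₄) :
    IsLorentzFrame h e₁ (-e₂) e₃ e₄ where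
  h11 := hF.h11
  h22 := by simp [hF.h22]
  h33 := hF.h33
  h44 := hF.h44
  h12 := by simp [hF.h12]
  h13 := hF.h13
  h14 := hF.h14
  h23 := by simp [hF.h23]
  h24 := by simp [hF.h24]
  h34 := hF.h34
  symm := hF.symm
  span x := by
    obtain ⟨a, b, c, d, rfl⟩ := hF.span x
    exact ⟨a, -b, c, d, by module⟩

theorem IsLorentzFrame.nondegenerate (hF : IsLorentzFrame h e₁ e₂ e₃ e₄) (x : V)
    (hx : ∀ y, h x y = 0) : x = 0 := by
  have h1 := hx e₁
  have h2 := hx e₂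
  have h3 := hx e₃
  have h4 := hx e₄
  obtain ⟨a, b, c, d, rfl⟩ := hF.span x
  simp [hF.h11, hF.h22, hF.h33, hF.h44, hF.h12, hF.h13, hF.h14, hF.h23, hF.h24, hF.h34,
    hF.symm e₂ e₁, hF.symm e₃ e₁, hF.symm e₄ e₁, hF.symm e₃ e₂, hF.symm e₄ e₂, hF.symm e₄ e₃]
    at h1 h2 h3 h4
  simp [h1, h2, h3, h4]

theorem IsLorentzFrame.isNullFrame (hF : IsLorentzFrame h e₁ e₂ e₃ e₄) :
    IsNullFrame h (e₃ + e₄) (e₃ - e₄) (e₁ + Complex.I • e₂) (e₁ - Complex.I • e₂) := by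
  constructor <;>
  simp [hF.h11, hF.h22, hF.h33, hF.h44, hF.h12, hF.h13, hF.h14, hF.h23, hF.h24, hF.h34,
    hF.symm e₂ e₁, hF.symm e₃ e₁, hF.symm e₄ e₁, hF.symm e₃ e₂, hF.symm e₄ e₂, hF.symm e₄ e₃]
  all_goals first | done | norm_num

/-- The null vectors X ± iY are eigenvectors of R(X + iY, X − iY) with eigenvalues ±2h(X,X)s, and Z,
being orthogonal to both, has eigenvalue 0. So σ(X ± iY, Z) = 0, and subtraction isolates σ(Y,Z). -/
theorem VanishesOnEigenpairs.eigenplane (hE : VanishesOnEigenpairs h S σ)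
    (hsymm : ∀ x y, h x y = h y x) {X Y Z : V} {s : ℂ} (hs : s ≠ 0)
    (hX : S X = s • X) (hY : S Y = s • Y) (hXY : h X Y = 0) (hXX : h X X ≠ 0)
    (hYY : h Y Y = h X X) (hXZ : h X Z = 0) (hYZ : h Y Z = 0) : σ Y Z = 0 := by
  have hYX : h Y X = 0 := by rw [hsymm, hXY]
  have hI := Complex.I_mul_I
  have g1 : h (X + Complex.I • Y) (X + Complex.I • Y) = 0 := by
    simp only [map_add, map_smul, LinearMap.add_apply, LinearMap.smul_apply, smul_eq_mul, hXY, hYX,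
      hYY]
    linear_combination h X X * hI
  have g2 : h (X - Complex.I • Y) (X - Complex.I • Y) = 0 := by
    simp only [map_sub, map_smul, LinearMap.sub_apply, LinearMap.smul_apply, smul_eq_mul, hXY, hYX,
      hYY]
    linear_combination h X X * hI
  have g3 : h (X + Complex.I • Y) (X - Complex.I • Y) = 2 * h X X := by
    simp only [map_add, map_sub, map_smul, LinearMap.add_apply, LinearMap.smul_apply, smul_eq_mul,
      hXY, hYX, hYY]
    linear_combination -h X X * hI
  have s1 : S (X + Complex.I • Y) = s • (X + Complex.I • Y) := by
    rw [map_add, map_smul, hX, hY]; module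
  have s2 : S (X - Complex.I • Y) = s • (X - Complex.I • Y) := by
    rw [map_sub, map_smul, hX, hY]; module
  have r1 : gaussTensor h S (X + Complex.I • Y) (X - Complex.I • Y) (X + Complex.I • Y) =
      (2 * h X X * s) • (X + Complex.I • Y) := by
    rw [gaussTensor_apply, g1, hsymm, g3, s1]; module
  have r2 : gaussTensor h S (X + Complex.I • Y) (X - Complex.I • Y) (X - Complex.I • Y) =
      (-(2 * h X X * s)) • (X - Complex.I • Y) := by
    rw [gaussTensor_apply, g2, g3, s2]; module
  have r3 : gaussTensor h S (X + Complex.I • Y) (X - Complex.I • Y) Z = (0 : ℂ) • Z := by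
    rw [gaussTensor_apply]
    simp [hXZ, hYZ]
  have ha : 2 * h X X * s ≠ 0 := mul_ne_zero (mul_ne_zero two_ne_zero hXX) hs
  have v1 := hE _ _ _ _ _ _ _ r1 r2 r1 r3 (by simpa using ha)
  have v2 := hE _ _ _ _ _ _ _ r1 r2 r2 r3 (by simpa using ha)
  simp only [map_add, map_sub, map_smul, LinearMap.add_apply, LinearMap.sub_apply,
    LinearMap.smul_apply, smul_eq_mul] at v1 v2
  have v3 : (2 * Complex.I) * σ Y Z = 0 := by linear_combination v1 - v2
  exact (mul_eq_zero.1 v3).resolve_left (mul_ne_zero two_ne_zero Complex.I_ne_zero)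

/-- The case of a shape operator `s + ν ⊗ ν` with `s ≠ 0` is impossible. -/
theorem VanishesOnEigenpairs.eigenvalue_eq_zero (hE : VanishesOnEigenpairs h S σ)
    (hF : IsLorentzFrame h e₁ e₂ e₃ e₄) (halt : ∀ x y, σ x y = -σ y x)
    (hσ : ∀ x, (∀ y, σ x y = 0) → x = 0) {s d u q : ℂ}
    (h1 : S e₁ = s • e₁) (h2 : S e₂ = s • e₂) (h3 : S e₃ = d • e₃ - u • e₄)
    (h4 : S e₄ = u • e₃ - q • e₄) (hdet : (s + q) * (s - d) = -u ^ 2) : s = 0 := by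
  by_contra hs
  have hs21 := hF.symm e₂ e₁
  have hs31 := hF.symm e₃ e₁
  have hs41 := hF.symm e₄ e₁
  have hs32 := hF.symm e₃ e₂
  have hs42 := hF.symm e₄ e₂
  have hs43 := hF.symm e₄ e₃
  rw [hF.h12] at hs21
  rw [hF.h13] at hs31
  rw [hF.h14] at hs41
  rw [hF.h23] at hs32
  rw [hF.h24] at hs42
  rw [hF.h34] at hs43
  have p : ∀ v, h e₁ v = 0 → h e₂ v = 0 → σ e₁ v = 0 ∧ σ e₂ v = 0 := fun v hv1 hv2 =>
    ⟨hE.eigenplane hF.symm hs h2 h1 hs21 (by simp [hF.h22]) (by rw [hF.h22, hF.h11]) hv2 hv1,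
      hE.eigenplane hF.symm hs h1 h2 hF.h12 (by simp [hF.h11]) (by rw [hF.h22, hF.h11]) hv1 hv2⟩
  have p3 := p e₃ hF.h13 hF.h23
  have p4 := p e₄ hF.h14 hF.h24
  -- By `hdet`, S − s is singular on the span of e₃ and e₄; (a, b) are the coordinates of a kernel
  -- vector κ = a e₃ + b e₄, which will turn out to lie in the kernel of σ.
  obtain ⟨a, b, hab, e1, e2⟩ : ∃ a b : ℂ, (a ≠ 0 ∨ b ≠ 0) ∧ (d - s) * a + u * b = 0 ∧
      u * a + (q + s) * b = 0 := by
    by_cases hu : u = 0 ∧ s - d = 0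
    · exact ⟨1, 0, Or.inl one_ne_zero, by linear_combination -hu.2, by linear_combination hu.1⟩
    · exact ⟨u, s - d, not_and_or.1 hu, by ring, by linear_combination hdet⟩
  have hk : S (a • e₃ + b • e₄) = s • (a • e₃ + b • e₄) := by
    have : S (a • e₃ + b • e₄) - s • (a • e₃ + b • e₄) =
        ((d - s) * a + u * b) • e₃ - (u * a + (q + s) * b) • e₄ := by
      rw [map_add, map_smul, map_smul, h3, h4]; module
    rw [e1, e2, zero_smul, zero_smul, sub_zero] at this
    exact sub_eq_zero.1 this
  -- The vector e₂ + tκ must have nonzero length. If t = 1 fails, then h(κ,κ) = −1 and t = 2 gives 1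
  -- − 4 = −3.
  obtain ⟨t, ht, hg⟩ : ∃ t : ℂ, t ≠ 0 ∧ 1 + t ^ 2 * (a ^ 2 - b ^ 2) ≠ 0 := by
    by_cases h0 : 1 + (a ^ 2 - b ^ 2) = 0
    · refine ⟨2, two_ne_zero, fun h5 => ?_⟩
      have : (3 : ℂ) = 0 := by linear_combination 4 * h0 - h5
      norm_num at this
    · exact ⟨1, one_ne_zero, by simpa using h0⟩
  obtain ⟨w, hw⟩ := IsAlgClosed.exists_pow_nat_eq (1 + t ^ 2 * (a ^ 2 - b ^ 2)) two_pos
  have key : ∀ v, h e₁ v = 0 → h e₂ v = 0 → σ e₂ v = 0 → σ (a • e₃ + b • e₄) v = 0 := by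
    intro v hv1 hv2 hv3
    have hX : h (w • e₁) (w • e₁) = 1 + t ^ 2 * (a ^ 2 - b ^ 2) := by
      simp only [map_smul, LinearMap.smul_apply, smul_eq_mul, hF.h11]
      linear_combination hw
    -- The scale w equalizes the lengths of w e₁ and e₂ + tκ, and the e₂-component of Z makes Z
    -- orthogonal to the latter. As σ(e₂,·) vanishes on e₂, κ and v, only −t σ(κ,v) remains.
    have h5 := hE.eigenplane hF.symm hs (X := w • e₁) (Y := e₂ + t • (a • e₃ + b • e₄))
      (Z := (t * h (a • e₃ + b • e₄) v) • e₂ - v) (by rw [map_smul, h1]; module)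
      (by rw [map_add, map_smul, hk, h2]; module)
      (by simp [hF.h12, hF.h13, hF.h14]) (by rwa [hX])
      (by rw [hX]; simp [hF.h22, hF.h23, hF.h24, hF.h33, hF.h34, hF.h44, hs32, hs42, hs43]; ring)
      (by simp [hF.h12, hv1])
      (by simp [hF.h22, hs32, hs42, hv2]; ring)
    have q3 : σ e₃ e₂ = 0 := by rw [halt, p3.2, neg_zero]
    have q4 : σ e₄ e₂ = 0 := by rw [halt, p4.2, neg_zero]
    have q2 : σ e₂ e₂ = 0 := by
      have := halt e₂ e₂
      linear_combination this / 2
    simp only [map_add, map_sub, map_smul, LinearMap.add_apply, LinearMap.smul_apply, smul_eq_mul,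
      q2, q3, q4, hv3] at h5
    have h6 : t * σ (a • e₃ + b • e₄) v = 0 := by
      simp only [map_add, map_smul, LinearMap.add_apply, LinearMap.smul_apply, smul_eq_mul]
      linear_combination -h5
    exact (mul_eq_zero.1 h6).resolve_left ht
  have hk0 : a • e₃ + b • e₄ = 0 := by
    apply hσ
    intro y
    obtain ⟨y1, y2, y3, y4, rfl⟩ := hF.span y
    have k3 := key e₃ hF.h13 hF.h23 p3.2
    have k4 := key e₄ hF.h14 hF.h24 p4.2
    have k1 : σ (a • e₃ + b • e₄) e₁ = 0 := by
      rw [halt]; simp [p3.1, p4.1]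
    have k2 : σ (a • e₃ + b • e₄) e₂ = 0 := by
      rw [halt]; simp [p3.2, p4.2]
    simp only [map_add _ (y1 • e₁ + y2 • e₂ + y3 • e₃), map_add _ (y1 • e₁ + y2 • e₂),
      map_add _ (y1 • e₁), map_smul _ y1, map_smul _ y2, map_smul _ y3, map_smul _ y4,
      k1, k2, k3, k4]
    simp
  have c3 := congrArg (h e₃) hk0
  have c4 := congrArg (h e₄) hk0
  simp [hF.h33, hF.h34, hF.h44, hs43] at c3 c4
  rcases hab with h0 | h0
  · exact h0 c3
  · exact h0 c4

/-- The conditions on a self-adjoint operator in an adapted Lorentz frame that express the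
degeneracy of a ruling. -/
def RulingRelations (d₁ d₂ d₃ u₁ u₂ u₃ q : ℝ) : Prop :=
  (u₁ * u₂ = 0 ∧ u₁ * u₃ = 0 ∧ u₂ * u₃ = 0) ∧
  ((d₁ - d₂) * u₃ = 0 ∧ (d₂ - d₃) * u₁ = 0 ∧ (d₃ - d₁) * u₂ = 0) ∧
  ((d₃ + q) * (d₁ - d₂) = u₁ ^ 2 - u₂ ^ 2 ∧ (d₁ + q) * (d₂ - d₃) = u₂ ^ 2 - u₃ ^ 2)

/-- The entries of S are real while the null frame is complex, so each coefficient of the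
determinant polynomial can yield two real equations. One ruling therefore suffices. -/
theorem IsLorentzFrame.rulingRelations (hF : IsLorentzFrame h e₁ e₂ e₃ e₄)
    {d₁ d₂ d₃ u₁ u₂ u₃ q : ℝ} (h1 : S e₁ = (d₁ : ℂ) • e₁ - (u₁ : ℂ) • e₄)
    (h2 : S e₂ = (d₂ : ℂ) • e₂ - (u₂ : ℂ) • e₄) (h3 : S e₃ = (d₃ : ℂ) • e₃ - (u₃ : ℂ) • e₄)
    (h4 : S e₄ = (u₁ : ℂ) • e₁ + (u₂ : ℂ) • e₂ + (u₃ : ℂ) • e₃ - (q : ℂ) • e₄)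
    (hdeg : IsDegenerateRuling h S (e₃ + e₄) (e₃ - e₄) (e₁ + Complex.I • e₂)
      (e₁ - Complex.I • e₂)) : RulingRelations d₁ d₂ d₃ u₁ u₂ u₃ q := by
  obtain ⟨c0, c1, c2, c3, c4⟩ := hdeg
  simp only [map_add, map_sub, map_smul, h1, h2, h3, h4, LinearMap.add_apply, LinearMap.sub_apply,
    LinearMap.smul_apply, smul_eq_mul,
    hF.h11, hF.h22, hF.h33, hF.h44, hF.h12, hF.h13, hF.h14, hF.h23, hF.h24, hF.h34,
    hF.symm e₂ e₁, hF.symm e₃ e₁, hF.symm e₄ e₁, hF.symm e₃ e₂, hF.symm e₄ e₂, hF.symm e₄ e₃,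
    mul_zero, mul_one, zero_add, add_zero, sub_zero, zero_sub, mul_neg] at c0 c1 c2 c3 c4
  have r0 := congrArg Complex.re c0
  have i0 := congrArg Complex.im c0
  have r1 := congrArg Complex.re c1
  have i1 := congrArg Complex.im c1
  have r2 := congrArg Complex.re c2
  have r3 := congrArg Complex.re c3
  have i3 := congrArg Complex.im c3
  have r4 := congrArg Complex.re c4
  have i4 := congrArg Complex.im c4
  simp [sq] at r0 i0 r1 i1 r2 r3 i3 r4 i4
  refine ⟨⟨?_, ?_, ?_⟩, ⟨?_, ?_, ?_⟩, ?_, ?_⟩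
  · linear_combination i0 / 2
  · linear_combination (r1 - r3) / 8
  · linear_combination -(i1 + i3) / 8
  · linear_combination (r0 - r4) / 4
  · linear_combination -(r1 + r3) / 8
  · linear_combination (i3 - i1) / 8
  · linear_combination (r0 + r4) / 2
  · linear_combination -(r2 + r0 + r4) / 4

/-- A nonzero uᵢ forces the other two u's to vanish and the other two d's to coincide. If all u's
vanish, the last two relations still make two of the d's equal. The surviving equation says that S
minus the repeated eigenvalue is singular on the remaining plane. -/
theorem RulingRelations.cases {d₁ d₂ d₃ u₁ u₂ u₃ q : ℝ} (h : RulingRelations d₁ d₂ d₃ u₁ u₂ u₃ q) :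
    (d₁ = d₂ ∧ u₁ = 0 ∧ u₂ = 0 ∧ (d₂ + q) * (d₂ - d₃) = -u₃ ^ 2) ∨
    (d₂ = d₃ ∧ u₂ = 0 ∧ u₃ = 0 ∧ (d₃ + q) * (d₃ - d₁) = -u₁ ^ 2) ∨
    (d₃ = d₁ ∧ u₃ = 0 ∧ u₁ = 0 ∧ (d₁ + q) * (d₁ - d₂) = -u₂ ^ 2) := by
  obtain ⟨⟨a1, a2, a3⟩, ⟨b1, b2, b3⟩, c1, c2⟩ := h
  by_cases h3 : u₃ = 0
  · by_cases h1 : u₁ = 0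
    · by_cases h2 : u₂ = 0
      · subst h1 h2 h3
        by_cases h12 : d₁ = d₂
        · exact Or.inl ⟨h12, rfl, rfl, by rw [h12] at c2; linear_combination c2⟩
        · have hq : d₃ + q = 0 :=
            (mul_eq_zero.1 (c1.trans (by ring))).resolve_right (sub_ne_zero.2 h12)
          rcases mul_eq_zero.1 (c2.trans (by ring)) with h5 | h5
          · exact Or.inr (Or.inr ⟨by linarith, rfl, rfl, by rw [h5]; ring⟩)
          · exact Or.inr (Or.inl ⟨by linarith, rfl, rfl, by rw [hq]; ring⟩)
      · have e1 : d₃ = d₁ := sub_eq_zero.1 ((mul_eq_zero.1 b3).resolve_right h2)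
        exact Or.inr (Or.inr ⟨e1, h3, h1, by rw [e1, h1] at c1; linear_combination c1⟩)
    · have e1 : d₂ = d₃ := sub_eq_zero.1 ((mul_eq_zero.1 b2).resolve_right h1)
      have e2 : u₂ = 0 := (mul_eq_zero.1 a1).resolve_left h1
      exact Or.inr (Or.inl ⟨e1, e2, h3, by rw [e1, e2] at c1; linear_combination -c1⟩)
  · have e1 : d₁ = d₂ := sub_eq_zero.1 ((mul_eq_zero.1 b1).resolve_right h3)
    have e2 : u₁ = 0 := (mul_eq_zero.1 a2).resolve_right h3
    have e4 : u₂ = 0 := (mul_eq_zero.1 a3).resolve_right h3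
    exact Or.inl ⟨e1, e2, e4, by rw [e1, e4] at c2; linear_combination c2⟩

/-- An operator in adapted form, `S e₁ = S e₂ = 0`, with rank at most one. -/
theorem VanishesOnEigenpairs.cases (hE : VanishesOnEigenpairs h S σ)
    (hF : IsLorentzFrame h e₁ e₂ e₃ e₄) (halt : ∀ x y, σ x y = -σ y x)
    (hσ : ∀ x, (∀ y, σ x y = 0) → x = 0) {d₁ d₂ d₃ u₁ u₂ u₃ q : ℝ}
    (h1 : S e₁ = (d₁ : ℂ) • e₁ - (u₁ : ℂ) • e₄)
    (h2 : S e₂ = (d₂ : ℂ) • e₂ - (u₂ : ℂ) • e₄) (h3 : S e₃ = (d₃ : ℂ) • e₃ - (u₃ : ℂ) • e₄)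
    (h4 : S e₄ = (u₁ : ℂ) • e₁ + (u₂ : ℂ) • e₂ + (u₃ : ℂ) • e₃ - (q : ℂ) • e₄) :
    (d₁ = 0 ∧ d₂ = 0 ∧ u₁ = 0 ∧ u₂ = 0 ∧ d₃ * q = u₃ ^ 2) ∨
    (d₂ = 0 ∧ d₃ = 0 ∧ u₂ = 0 ∧ u₃ = 0 ∧ d₁ * q = u₁ ^ 2) ∨
    (d₃ = 0 ∧ d₁ = 0 ∧ u₃ = 0 ∧ u₁ = 0 ∧ d₂ * q = u₂ ^ 2) := by
  have hadj : ∀ x y, h x (S y) = h y (S x) := by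
    intro x y
    obtain ⟨x1, x2, x3, x4, rfl⟩ := hF.span x
    obtain ⟨y1, y2, y3, y4, rfl⟩ := hF.span y
    simp only [map_add, map_sub, map_smul, h1, h2, h3, h4, LinearMap.add_apply,
      LinearMap.smul_apply, smul_eq_mul,
      hF.h11, hF.h22, hF.h33, hF.h44, hF.h12, hF.h13, hF.h14, hF.h23, hF.h24, hF.h34,
      hF.symm e₂ e₁, hF.symm e₃ e₁, hF.symm e₄ e₁, hF.symm e₃ e₂, hF.symm e₄ e₂, hF.symm e₄ e₃]
    ring
  have final : RulingRelations d₁ d₂ d₃ u₁ u₂ u₃ q →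
      (d₁ = 0 ∧ d₂ = 0 ∧ u₁ = 0 ∧ u₂ = 0 ∧ d₃ * q = u₃ ^ 2) ∨
      (d₂ = 0 ∧ d₃ = 0 ∧ u₂ = 0 ∧ u₃ = 0 ∧ d₁ * q = u₁ ^ 2) ∨
      (d₃ = 0 ∧ d₁ = 0 ∧ u₃ = 0 ∧ u₁ = 0 ∧ d₂ * q = u₂ ^ 2) := by
    intro hr
    rcases hr.cases with ⟨rfl, rfl, rfl, hd⟩ | ⟨rfl, rfl, rfl, hd⟩ | ⟨rfl, rfl, rfl, hd⟩
    · have h0 := hE.eigenvalue_eq_zero hF halt hσ (s := d₁) (d := d₃) (u := u₃) (q := q)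
        (by rw [h1]; simp) (by rw [h2]; simp) h3 (by rw [h4]; simp) (by exact_mod_cast hd)
      rw [Complex.ofReal_eq_zero] at h0
      subst h0
      exact Or.inl ⟨rfl, rfl, rfl, rfl, by linear_combination -hd⟩
    · have h0 := hE.eigenvalue_eq_zero hF.rotate halt hσ (s := d₂) (d := d₁) (u := u₁) (q := q)
        (by rw [h2]; simp) (by rw [h3]; simp) h1 (by rw [h4]; simp) (by exact_mod_cast hd)
      rw [Complex.ofReal_eq_zero] at h0
      subst h0
      exact Or.inr (Or.inl ⟨rfl, rfl, rfl, rfl, by linear_combination -hd⟩)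
    · have h0 := hE.eigenvalue_eq_zero hF.rotate.rotate halt hσ (s := d₃) (d := d₂) (u := u₂)
        (q := q) (by rw [h3]; simp) (by rw [h1]; simp) h2 (by rw [h4]; simp) (by exact_mod_cast hd)
      rw [Complex.ofReal_eq_zero] at h0
      subst h0
      exact Or.inr (Or.inr ⟨rfl, rfl, rfl, rfl, by linear_combination -hd⟩)
  have hN := hF.isNullFrame
  have hN' := hF.reflect.isNullFrame
  have hm : e₁ + Complex.I • -e₂ = e₁ - Complex.I • e₂ := by module
  have hm' : e₁ - Complex.I • -e₂ = e₁ + Complex.I • e₂ := by module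
  rcases hE.ruling hF.symm hadj hN with hd | hv
  · exact final (hF.rulingRelations h1 h2 h3 h4 hd)
  rcases hE.ruling hF.symm hadj hN' with hd | hv'
  · have hr := hF.reflect.rulingRelations (d₁ := d₁) (d₂ := d₂) (d₃ := d₃) (u₁ := u₁) (u₂ := -u₂)
      (u₃ := u₃) (q := q) h1
      (by rw [map_neg, h2]; push_cast; module) h3 (by rw [h4]; push_cast; module) hd
    obtain ⟨⟨a1, a2, a3⟩, ⟨b1, b2, b3⟩, c1, c2⟩ := hr
    exact final ⟨⟨by linear_combination -a1, a2, by linear_combination -a3⟩,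
      ⟨b1, b2, by linear_combination -b3⟩, by linear_combination c1, by linear_combination c2⟩
  · rw [hm, hm'] at hv'
    have hS : S = 0 := by
      refine eq_zero_of_both_rulings hF.symm hF.nondegenerate halt hσ hadj hN ?_ hv hv'
      intro x
      obtain ⟨a, b, c, d, rfl⟩ := hF.span x
      -- Inverts l, n = e₃ ± e₄ and m, m' = e₁ ± i e₂.
      refine ⟨(c + d) / 2, (c - d) / 2, (a - Complex.I * b) / 2, (a + Complex.I * b) / 2, ?_⟩
      have hI := Complex.I_mul_I
      match_scalars
      · ring
      · linear_combination b * hI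
      · ring
      · ring
    have hz : ∀ {d u : ℝ} {e : V}, h e e = 1 → h e e₄ = 0 → S e = (d : ℂ) • e - (u : ℂ) • e₄ →
        d = 0 ∧ u = 0 := by
      intro d u e he he₄ hSe
      rw [hS, LinearMap.zero_apply] at hSe
      have z := congrArg (h e) hSe
      have z' := congrArg (h e₄) hSe
      simp only [map_zero, map_sub, map_smul, he, he₄, hF.symm e₄ e, hF.h44, smul_eq_mul, mul_one,
        mul_zero, sub_zero] at z z'
      exact ⟨by exact_mod_cast z.symm, by simpa using z'.symm⟩
    obtain ⟨rfl, rfl⟩ := hz hF.h11 hF.h14 h1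
    obtain ⟨rfl, rfl⟩ := hz hF.h22 hF.h24 h2
    obtain ⟨rfl, rfl⟩ := hz hF.h33 hF.h34 h3
    simp

end LorentzFrame
end AffineHypersurface
end

noncomputable section

namespace AffineHypersurface

/-! ### A real frame adapted to h and S, and the rank bound -/

section RealFrame

variable {V : Type*} [AddCommGroup V] [Module ℝ V]

/-- S need not be diagonalizable for an indefinite form. Its compression to a positive definite
3-space is symmetric, however, and the spectral theorem there removes the three spacelike
off-diagonal entries, leaving the entries with e₄. -/
theorem exists_diagonalizing_frame (B : V →ₗ[ℝ] V →ₗ[ℝ] ℝ) (S : V →ₗ[ℝ] V)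
    (hB : HasSignature (fun u v => B u v) 3 1) (hadj : ∀ u v, B u (S v) = B v (S u)) :
    ∃ e₁ e₂ e₃ e₄ : V, IsLorentzFrame B e₁ e₂ e₃ e₄ ∧
      B e₁ (S e₂) = 0 ∧ B e₂ (S e₃) = 0 ∧ B e₃ (S e₁) = 0 := by
  obtain ⟨b, hb'⟩ := hB
  have hb : ∀ i j, B (b i) (b j) = if i = j then Sum.elim (fun _ => (1 : ℝ)) (fun _ => -1) i else 0 :=
    hb'
  have hsymm : ∀ x y, B x y = B y x := by
    intro x y
    refine LinearMap.congr_fun₂ (f := B) (g := B.flip) (b.ext fun i => b.ext fun j => ?_) x y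
    rw [LinearMap.flip_apply, hb, hb]
    by_cases h : i = j
    · subst h; rfl
    · rw [if_neg h, if_neg (Ne.symm h)]
  let L : EuclideanSpace ℝ (Fin 3) →ₗ[ℝ] V :=
    Fintype.linearCombination ℝ (fun i : Fin 3 => b (Sum.inl i)) ∘ₗ
      (WithLp.linearEquiv 2 ℝ (Fin 3 → ℝ)).toLinearMap
  have hL : ∀ x, L x = ∑ i, x i • b (Sum.inl i) := fun x => by
    simp [L, Fintype.linearCombination_apply]
  have hLL : ∀ x y, B (L x) (L y) = inner ℝ x y := by
    intro x y
    simp [hL, hb, PiLp.inner_apply, mul_comm]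
  have hL4 : ∀ x, B (L x) (b (Sum.inr 0)) = 0 := by
    intro x
    simp [hL, hb]
  let A : Matrix (Fin 3) (Fin 3) ℝ := Matrix.of fun i j => B (b (Sum.inl i)) (S (b (Sum.inl j)))
  have hA : A.IsHermitian := by
    ext i j
    simpa [A] using hadj _ _
  have hAL : ∀ x y, inner ℝ x (Matrix.toEuclideanLin A y) = B (L x) (S (L y)) := by
    intro x y
    simp [hL, PiLp.inner_apply, A, Matrix.toLpLin_apply, Matrix.mulVec, dotProduct, Finset.sum_mul,
      Finset.mul_sum]
    rw [Finset.sum_comm]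
    exact Finset.sum_congr rfl fun i _ => Finset.sum_congr rfl fun j _ => by ring
  have hT := Matrix.isSymmetric_toEuclideanLin_iff.2 hA
  let v := hT.eigenvectorBasis (n := 3) (by simp)
  have hv : ∀ i j, i ≠ j → B (L (v i)) (S (L (v j))) = 0 := by
    intro i j hij
    rw [← hAL, hT.apply_eigenvectorBasis, inner_smul_right, OrthonormalBasis.inner_eq_ite,
      if_neg hij, mul_zero]
  have hv' : ∀ i j, B (L (v i)) (L (v j)) = if i = j then 1 else 0 := fun i j => by
    rw [hLL, OrthonormalBasis.inner_eq_ite]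
  refine ⟨L (v 0), L (v 1), L (v 2), b (Sum.inr 0), ⟨by simp [hv'], by simp [hv'], by simp [hv'],
    by simp [hb], by simp [hv'], by simp [hv'], hL4 _, by simp [hv'], hL4 _, hL4 _, hsymm, ?_⟩,
    hv _ _ (by decide), hv _ _ (by decide), hv _ _ (by decide)⟩
  intro x
  let y : EuclideanSpace ℝ (Fin 3) := WithLp.toLp 2 fun i => b.repr x (Sum.inl i)
  refine ⟨v.repr y 0, v.repr y 1, v.repr y 2, b.repr x (Sum.inr 0), ?_⟩
  have hx : x = L y + b.repr x (Sum.inr 0) • b (Sum.inr 0) := by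
    rw [hL]
    conv_lhs => rw [← b.sum_repr x, Fintype.sum_sum_type]
    simp [y]
  have hy : L y = v.repr y 0 • L (v 0) + v.repr y 1 • L (v 1) + v.repr y 2 • L (v 2) := by
    conv_lhs => rw [← v.sum_repr y]
    simp [Fin.sum_univ_three]
  rw [← hy]
  exact hx

theorem IsLorentzFrame.expand {B : V →ₗ[ℝ] V →ₗ[ℝ] ℝ} {e₁ e₂ e₃ e₄ : V}
    (hF : IsLorentzFrame B e₁ e₂ e₃ e₄) (x : V) :
    x = B e₁ x • e₁ + B e₂ x • e₂ + B e₃ x • e₃ - B e₄ x • e₄ := by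
  obtain ⟨a, b, c, d, rfl⟩ := hF.span x
  simp only [map_add, map_smul, hF.h11, hF.h22, hF.h33, hF.h44, hF.h12, hF.h13, hF.h14, hF.h23,
    hF.h24, hF.h34, hF.symm e₂ e₁, hF.symm e₃ e₁, hF.symm e₄ e₁, hF.symm e₃ e₂, hF.symm e₄ e₂,
    hF.symm e₄ e₃, smul_eq_mul]
  module

/-- The equation d q = u² is the vanishing of the determinant of S on the span of e₃ and e₄, so S e₃
and S e₄ are proportional. -/
theorem IsLorentzFrame.finrank_range_le_one {B : V →ₗ[ℝ] V →ₗ[ℝ] ℝ} {S : V →ₗ[ℝ] V}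
    {e₁ e₂ e₃ e₄ : V} (hF : IsLorentzFrame B e₁ e₂ e₃ e₄) {d u q : ℝ} (h1 : S e₁ = 0)
    (h2 : S e₂ = 0) (h3 : S e₃ = d • e₃ - u • e₄) (h4 : S e₄ = u • e₃ - q • e₄)
    (hd : d * q = u ^ 2) : Module.finrank ℝ (LinearMap.range S) ≤ 1 := by
  have key : ∀ v : V, (∃ c : ℝ, S e₃ = c • v) → (∃ c : ℝ, S e₄ = c • v) →
      Module.finrank ℝ (LinearMap.range S) ≤ 1 := by
    rintro v ⟨c, hc⟩ ⟨c', hc'⟩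
    have hle : LinearMap.range S ≤ Submodule.span ℝ {v} := by
      rintro _ ⟨x, rfl⟩
      obtain ⟨x₁, x₂, x₃, x₄, rfl⟩ := hF.span x
      refine Submodule.mem_span_singleton.2 ⟨x₃ * c + x₄ * c', ?_⟩
      simp only [map_add, map_smul, h1, h2, hc, hc']
      module
    exact (Submodule.finrank_mono hle).trans ((finrank_span_le_card {v}).trans (by simp))
  by_cases hd0 : d = 0
  · obtain rfl : u = 0 := by
      rw [hd0, zero_mul] at hd
      exact pow_eq_zero_iff two_ne_zero |>.1 hd.symm
    exact key (S e₄) ⟨0, by simp [h3, hd0]⟩ ⟨1, by simp⟩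
  · refine key (S e₃) ⟨1, by simp⟩ ⟨u / d, ?_⟩
    rw [h3, h4]
    match_scalars <;> field_simp
    linear_combination -hd

end RealFrame

section Complexification

/-! ### Complexification and the pointwise theorem -/

open TensorProduct

variable {V : Type*} [AddCommGroup V] [Module ℝ V]

theorem exists_eq_tmul_add_I_smul (x : ℂ ⊗[ℝ] V) :
    ∃ u v : V, x = (1 : ℂ) ⊗ₜ[ℝ] u + Complex.I • ((1 : ℂ) ⊗ₜ[ℝ] v) := by
  induction x with
  | zero => exact ⟨0, 0, by simp⟩
  | tmul z w =>
    refine ⟨z.re • w, z.im • w, ?_⟩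
    rw [← TensorProduct.smul_tmul, ← TensorProduct.smul_tmul, TensorProduct.smul_tmul',
      ← TensorProduct.add_tmul]
    congr 1
    apply Complex.ext <;> simp
  | add x y hx hy =>
    obtain ⟨u, v, rfl⟩ := hx
    obtain ⟨u', v', rfl⟩ := hy
    exact ⟨u + u', v + v', by simp only [TensorProduct.tmul_add]; module⟩

theorem one_tmul_real_smul (a : ℝ) (v : V) :
    (1 : ℂ) ⊗ₜ[ℝ] (a • v) = (a : ℂ) • ((1 : ℂ) ⊗ₜ[ℝ] v) := by
  rw [← TensorProduct.smul_tmul, TensorProduct.smul_tmul']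
  simp

/-- The complexification of a real bilinear form. -/
def complexForm (B : V →ₗ[ℝ] V →ₗ[ℝ] ℝ) : ℂ ⊗[ℝ] V →ₗ[ℂ] ℂ ⊗[ℝ] V →ₗ[ℂ] ℂ :=
  LinearMap.BilinForm.baseChange ℂ B

@[simp] theorem complexForm_one_tmul (B : V →ₗ[ℝ] V →ₗ[ℝ] ℝ) (u v : V) :
    complexForm B ((1 : ℂ) ⊗ₜ[ℝ] u) ((1 : ℂ) ⊗ₜ[ℝ] v) = B u v := by
  simp [complexForm]

theorem complexForm_nondegenerate {B : V →ₗ[ℝ] V →ₗ[ℝ] ℝ} (hB : ∀ u, (∀ v, B u v = 0) → u = 0)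
    (x : ℂ ⊗[ℝ] V) (hx : ∀ y, complexForm B x y = 0) : x = 0 := by
  obtain ⟨u, v, rfl⟩ := exists_eq_tmul_add_I_smul x
  have key : ∀ w, B u w = 0 ∧ B v w = 0 := by
    intro w
    have h := hx ((1 : ℂ) ⊗ₜ[ℝ] w)
    simpa [Complex.ext_iff] using h
  rw [hB u fun w => (key w).1, hB v fun w => (key w).2]
  simp

/-- The sign ε treats symmetric (ε = 1) and alternating (ε = −1) forms at once. -/
theorem complexForm_swap {B : V →ₗ[ℝ] V →ₗ[ℝ] ℝ} {ε : ℝ} (hB : ∀ u v, B u v = ε * B v u)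
    (x y : ℂ ⊗[ℝ] V) : complexForm B x y = ε * complexForm B y x := by
  obtain ⟨u, v, rfl⟩ := exists_eq_tmul_add_I_smul x
  obtain ⟨u', v', rfl⟩ := exists_eq_tmul_add_I_smul y
  simp [hB u, hB v]
  ring

theorem complexForm_isLorentzFrame {B : V →ₗ[ℝ] V →ₗ[ℝ] ℝ} {e₁ e₂ e₃ e₄ : V}
    (hF : IsLorentzFrame B e₁ e₂ e₃ e₄) :
    IsLorentzFrame (complexForm B) ((1 : ℂ) ⊗ₜ[ℝ] e₁) ((1 : ℂ) ⊗ₜ[ℝ] e₂) ((1 : ℂ) ⊗ₜ[ℝ] e₃)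
      ((1 : ℂ) ⊗ₜ[ℝ] e₄) where
  h11 := by simp [hF.h11]
  h22 := by simp [hF.h22]
  h33 := by simp [hF.h33]
  h44 := by simp [hF.h44]
  h12 := by simp [hF.h12]
  h13 := by simp [hF.h13]
  h14 := by simp [hF.h14]
  h23 := by simp [hF.h23]
  h24 := by simp [hF.h24]
  h34 := by simp [hF.h34]
  symm x y := by simpa using complexForm_swap (ε := 1) (by simpa using hF.symm) x y
  span x := by
    obtain ⟨u, v, rfl⟩ := exists_eq_tmul_add_I_smul x
    obtain ⟨a, b, c, d, rfl⟩ := hF.span u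
    obtain ⟨a', b', c', d', rfl⟩ := hF.span v
    refine ⟨a + Complex.I * a', b + Complex.I * b', c + Complex.I * c', d + Complex.I * d', ?_⟩
    simp only [TensorProduct.tmul_add, one_tmul_real_smul]
    module

/-- The identity R^k·σ = 0 extends from real to complex vectors by multilinearity, since a real
basis is a complex basis of the complexification. From here on k no longer appears. -/
theorem vanishesOnEigenpairs_of_curvaturePower_eq_zero [FiniteDimensional ℝ V]
    (B σ : V →ₗ[ℝ] V →ₗ[ℝ] ℝ) (S : V →ₗ[ℝ] V) (k : ℕ)
    (h0 : ∀ X, curvaturePower (fun u v w => B v w • S u - B u w • S v)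
      (fun X : Fin 2 → V => σ (X 0) (X 1)) k X = 0) :
    VanishesOnEigenpairs (complexForm B) (S.baseChange ℂ) (complexForm σ) := by
  let T : MultilinearMap ℂ (fun _ : Fin 2 => ℂ ⊗[ℝ] V) ℂ :=
    MultilinearMap.mk' (fun X => complexForm σ (X 0) (X 1))
      (by intro m i x y; fin_cases i <;> simp) (by intro m i c x; fin_cases i <;> simp)
  let b := Module.finBasis ℝ V
  have hT : complexPower (gaussTensor (complexForm B) (S.baseChange ℂ)) T k = 0 := by
    refine complexPower_eq_zero (b.baseChange ℂ) b (fun v => (1 : ℂ) ⊗ₜ[ℝ] v)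
      (fun i => by simp) (fun u v w => B v w • S u - B u w • S v) _ ?_
      (fun X : Fin 2 → V => σ (X 0) (X 1)) T ?_ k h0
    · intro u v w
      simp only [gaussTensor_apply, complexForm_one_tmul, LinearMap.baseChange_tmul,
        TensorProduct.tmul_sub, one_tmul_real_smul]
    · intro X
      simp [T]
  intro X Y Z W a z w hX hY hZ hW hzw
  simpa [T] using eq_zero_of_complexPower_eq_zero _ T hT hX hY hZ hW hzw

theorem finrank_range_le_one_of_curvaturePower_eq_zero [FiniteDimensional ℝ V]
    (B σ : V →ₗ[ℝ] V →ₗ[ℝ] ℝ) (S : V →ₗ[ℝ] V) (k : ℕ)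
    (hB : HasSignature (fun u v => B u v) 3 1) (hadj : ∀ u v, B u (S v) = B v (S u))
    (halt : ∀ u, σ u u = 0) (hσ : ∀ u, (∀ v, σ u v = 0) → u = 0)
    (h0 : ∀ X, curvaturePower (fun u v w => B v w • S u - B u w • S v)
      (fun X : Fin 2 → V => σ (X 0) (X 1)) k X = 0) :
    Module.finrank ℝ (LinearMap.range S) ≤ 1 := by
  obtain ⟨e₁, e₂, e₃, e₄, hF, h12, h23, h31⟩ := exists_diagonalizing_frame B S hB hadj
  have hanti : ∀ u v, σ u v = -σ v u := by
    intro u v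
    have h := halt (u + v)
    simp only [map_add, LinearMap.add_apply, halt, zero_add, add_zero] at h
    linear_combination h
  have h1 : S e₁ = B e₁ (S e₁) • e₁ - B e₁ (S e₄) • e₄ := by
    conv_lhs => rw [hF.expand (S e₁), hadj e₂, h12, h31, hadj e₄]
    module
  have h2 : S e₂ = B e₂ (S e₂) • e₂ - B e₂ (S e₄) • e₄ := by
    conv_lhs => rw [hF.expand (S e₂), h12, hadj e₃, h23, hadj e₄]
    module
  have h3 : S e₃ = B e₃ (S e₃) • e₃ - B e₃ (S e₄) • e₄ := by
    conv_lhs => rw [hF.expand (S e₃), h23, hadj e₁, h31, hadj e₄]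
    module
  have h4 := hF.expand (S e₄)
  set d₁ := B e₁ (S e₁)
  set d₂ := B e₂ (S e₂)
  set d₃ := B e₃ (S e₃)
  set u₁ := B e₁ (S e₄)
  set u₂ := B e₂ (S e₄)
  set u₃ := B e₃ (S e₄)
  set q := B e₄ (S e₄)
  have hE := vanishesOnEigenpairs_of_curvaturePower_eq_zero B σ S k h0
  have hC : ∀ {x y : V}, x = y → (1 : ℂ) ⊗ₜ[ℝ] x = (1 : ℂ) ⊗ₜ[ℝ] y := fun h => by rw [h]
  rcases hE.cases (complexForm_isLorentzFrame hF)
    (by simpa using complexForm_swap (B := σ) (ε := -1) (by simpa using hanti))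
    (complexForm_nondegenerate hσ) (d₁ := d₁) (d₂ := d₂) (d₃ := d₃) (u₁ := u₁) (u₂ := u₂)
    (u₃ := u₃) (q := q)
    (by
      simpa only [LinearMap.baseChange_tmul, TensorProduct.tmul_sub, one_tmul_real_smul] using hC h1)
    (by
      simpa only [LinearMap.baseChange_tmul, TensorProduct.tmul_sub, one_tmul_real_smul] using hC h2)
    (by
      simpa only [LinearMap.baseChange_tmul, TensorProduct.tmul_sub, one_tmul_real_smul] using hC h3)
    (by
      simpa only [LinearMap.baseChange_tmul, TensorProduct.tmul_sub, TensorProduct.tmul_add, one_tmul_real_smul] using hC h4) with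
    ⟨z1, z2, z3, z4, hq⟩ | ⟨z1, z2, z3, z4, hq⟩ | ⟨z1, z2, z3, z4, hq⟩
  all_goals simp only [z1, z2, z3, z4, zero_smul, sub_zero, zero_add, add_zero] at h1 h2 h3 h4
  · exact hF.finrank_range_le_one h1 h2 h3 h4 hq
  · exact hF.rotate.finrank_range_le_one h2 h3 h1 h4 hq
  · exact hF.rotate.rotate.finrank_range_le_one h3 h1 h2 h4 hq

end Complexification
end AffineHypersurface
end

/-! ### The theorem on the manifold -/

theorem mainTheorem1 {M : Type*} [TopologicalSpace M]
    [ChartedSpace (EuclideanSpace ℝ (Fin 4)) M]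
    [IsManifold 𝓘(ℝ, EuclideanSpace ℝ (Fin 4)) ∞ M]
    (f ξ : M → EuclideanSpace ℝ (Fin 5))
    (hf : AffineHypersurface.IsTransversalPair (E := EuclideanSpace ℝ (Fin 4)) f ξ)
    (hnd : AffineHypersurface.IsNondegenerate (E := EuclideanSpace ℝ (Fin 4)) f ξ)
    (hequi : AffineHypersurface.IsLocallyEquiaffine (E := EuclideanSpace ℝ (Fin 4)) f ξ)
    (hlor : ∀ x : M, AffineHypersurface.HasSignature
      (AffineHypersurface.secondFundamentalForm (E := EuclideanSpace ℝ (Fin 4)) f ξ x) 3 1)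
    (Ω : Π x : M, TangentSpace 𝓘(ℝ, EuclideanSpace ℝ (Fin 4)) x →L[ℝ]
      TangentSpace 𝓘(ℝ, EuclideanSpace ℝ (Fin 4)) x →L[ℝ] ℝ)
    (hΩ : AffineHypersurface.IsAlmostSymplectic Ω)
    (k : ℕ) (hk : 1 ≤ k)
    (hR : ∀ (x : M) (X : Fin (2 + 2 * k) → TangentSpace 𝓘(ℝ, EuclideanSpace ℝ (Fin 4)) x),
      AffineHypersurface.curvaturePowerForm f ξ Ω k x X = 0) :
    ∀ x : M, Module.finrank ℝ (LinearMap.range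
      (AffineHypersurface.shapeOperator (E := EuclideanSpace ℝ (Fin 4)) f ξ x).toLinearMap) ≤ 1 := by
  intro x
  -- The tangent space at x is the model space itself, so h, Ω and S at x become plain
  -- linear-algebra data.
  let B : EuclideanSpace ℝ (Fin 4) →ₗ[ℝ] EuclideanSpace ℝ (Fin 4) →ₗ[ℝ] ℝ :=
    (ContinuousLinearMap.coeLM ℝ).comp (AffineHypersurface.chartForm f ξ x).toLinearMap
  let Ωx : EuclideanSpace ℝ (Fin 4) →L[ℝ] EuclideanSpace ℝ (Fin 4) →L[ℝ] ℝ := Ω x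
  let σ : EuclideanSpace ℝ (Fin 4) →ₗ[ℝ] EuclideanSpace ℝ (Fin 4) →ₗ[ℝ] ℝ :=
    (ContinuousLinearMap.coeLM ℝ).comp Ωx.toLinearMap
  let S : EuclideanSpace ℝ (Fin 4) →ₗ[ℝ] EuclideanSpace ℝ (Fin 4) :=
    (AffineHypersurface.chartShape f ξ x).toLinearMap
  have hB : (AffineHypersurface.secondFundamentalForm (E := EuclideanSpace ℝ (Fin 4)) f ξ x) =
      fun u v => B u v := by
    funext u v
    exact AffineHypersurface.secondFundamentalForm_eq hf u v
  have hS : (AffineHypersurface.shapeOperator (E := EuclideanSpace ℝ (Fin 4)) f ξ x).toLinearMap =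
      S := LinearMap.ext fun u => AffineHypersurface.shapeOperator_eq hf u
  have hK : AffineHypersurface.inducedCurvature (E := EuclideanSpace ℝ (Fin 4)) f ξ x =
      fun u v w => B v w • S u - B u w • S v := by
    funext u v w
    exact AffineHypersurface.inducedCurvature_eq hf u v w
  have hsig := hlor x
  rw [hB] at hsig
  rw [hS]
  refine AffineHypersurface.finrank_range_le_one_of_curvaturePower_eq_zero B σ S k hsig
    (AffineHypersurface.chartForm_chartShape hf hequi) (hΩ.alternating x)
    (hΩ.nondegenerate x) fun X => ?_
  have h := hR x X
  rw [AffineHypersurface.curvaturePowerForm, hK] at h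
  exact h
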